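/- Let $\mathbb K$ be an algebraically closed field of characteristic $0$, let $q\in\mathbb K^*$, write $[k]=q^{k-1}+q^{k-3}+\dots+q^{1-k}$, and suppose that $\ell=\mathbf{char}(q):=\min\{k>0 : [k]=0\}$ exists and is at least $3$. Let $m\ge 2$, $n\ge 0$, $r\ge 1$, and let $\mathcal U_q$ be the small quantum superalgebra $u_q(\mathfrak{gl}(m|n))$ (the quotient of the quantum general linear superalgebra $U_q(\mathfrak{gl}(m|n))$ with generators $e_j,f_j$ $(1\le j<m+n)$, $K_i^{\pm1}$ $(1\le i\le m+n)$ by the relations that the $\ell$-th powers of the even root vectors vanish and $K_i^{2\ell}=1$), or $U_q(\mathfrak{gl}(m|n))$ itself. The quantum Grassmann superalgebra $\Omega_q(m|n)$ has the basis of the monomials $x^{\langle\alpha,\mu\rangle}=x^{(\alpha)}\otimes x^{\mu}$ with $\alpha\in\mathbb Z_{\ge0}^m$, $\mu\in\{0,1\}^n$. Regard $\langle\alpha,\mu\rangle$ as an $(m+n)$-tuple $\beta$ with unit vectors $\varepsilon_i$, and put $c_i(\beta)=[\beta_i+1]$ for $i\le m$ and $c_i(\beta)=\delta_{0,\beta_i}$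 for $i>m$. Then $\mathcal U_q$ acts by $e_j x^{\beta}=c_j(\beta)\,x^{\beta+\varepsilon_j-\varepsilon_{j+1}}$, $f_j x^{\beta}=c_{j+1}(\beta)\,x^{\beta-\varepsilon_j+\varepsilon_{j+1}}$ (read as $0$ if an exponent would become negative), and $K_i x^\beta=q^{\beta_i}x^\beta$ for $i\le m$, $K_ix^\beta=q^{-\beta_i}x^\beta$ for $i>m$. For $0\le s\le N=m(r\ell-1)+n$ let $\Omega_q^{(s)}(m|n,\mathbf r)$ be the submodule spanned by the monomials $x^{\langle\alpha,\mu\rangle}$ with $\sum\alpha_i+\sum\mu_j=s$ and $\alpha_i\le r\ell-1$ for all $i$. The energy grade of $x^{\langle\alpha,\mu\rangle}$ is $\sum_{i=1}^m\lfloor\alpha_i/\ell\rfloor$, that of a nonzero element is the largest energy grade of a monomial occurring in it, and $E_0(s)$, $E(s)$ are the lowest and highest energy grades of nonzero elements of $\Omega_q^{(s)}(m|n,\mathbf r)$. For $0\le i\le E(s)-E_0(s)$ let $\mathcal V_i$ be the span of the monomials in $\Omega_q^{(s)}(m|n,\mathbf r)$ of energy grade at most $E_0(s)+i$. **Theorem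 (Rigidity).** Every $\mathcal U_q$-module $M=\Omega_q^{(s)}(m|n,\mathbf r)$, $0\le s\le N$, is rigid, i.e. with $t$ denoting its Loewy length (the least length of a filtration with semisimple successive quotients), its socle and radical filtrations coincide: $\mathrm{Rad}^{t-k}M=\mathrm{Soc}^kM$ for $0\le k\le t$. Moreover $t=E(s)-E_0(s)+1$, and both filtrations are the energy-grade filtration: $\mathrm{Soc}^{i+1}M=\mathcal V_i=\mathrm{Rad}^{E(s)-E_0(s)-i}M$ for $0\le i\le E(s)-E_0(s)$. -/

import Mathlib

set_option linter.unusedSectionVars false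
set_option linter.unusedSimpArgs false
set_option linter.unusedVariables false
set_option linter.unnecessarySeqFocus false
set_option linter.unusedTactic false

namespace QGrass

section qNumbers
variable {K : Type*} [Field K]

/-- The quantum integer `[k] = (v^k - v^(-k)) / (v - v⁻¹)`, an element of `ℤ[v, v⁻¹]`, specialised
at `v = q`: it is `q^(k-1) + q^(k-3) + ⋯ + q^(1-k)`. -/
def qInt (q : K) (k : ℕ) : K := ∑ i ∈ Finset.range k, q ^ ((k : ℤ) - 1 - 2 * (i : ℤ))

/-- The characteristic of `q`: the least `l > 0` with `[l] = 0`, and `0` if there is none. -/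
noncomputable def qChar (q : K) : ℕ := sInf {l : ℕ | 0 < l ∧ qInt q l = 0}

theorem qInt_zero (q : K) : qInt q 0 = 0 := by simp [qInt]

theorem qInt_one (q : K) : qInt q 1 = 1 := by simp [qInt]

theorem qInt_mul_sub (q : K) (hq : q ≠ 0) (k : ℕ) :
    qInt q k * (q - q⁻¹) = q ^ (k : ℤ) - q ^ (-(k : ℤ)) := by
  rw [qInt, Finset.sum_mul]
  have h : ∀ i ∈ Finset.range k, q ^ ((k : ℤ) - 1 - 2 * (i : ℤ)) * (q - q⁻¹) =
      q ^ ((k : ℤ) - 2 * (i : ℤ)) - q ^ ((k : ℤ) - 2 * ((i + 1 : ℕ) : ℤ)) := by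
    intro i _
    rw [mul_sub, ← zpow_add_one₀ hq, ← zpow_sub_one₀ hq]
    congr 2 <;> push_cast <;> ring
  rw [Finset.sum_congr rfl h, Finset.sum_range_sub']
  congr 2 <;> push_cast <;> ring

theorem qInt_ne_of_lt (q : K) {k : ℕ} (h0 : 0 < k) (h : k < qChar q) : qInt q k ≠ 0 := fun hk =>
  Nat.notMem_of_lt_sInf h ⟨h0, hk⟩

variable [CharZero K] (q : K) [hq : Fact (3 ≤ qChar q)]

theorem qInt_qChar : qInt q (qChar q) = 0 := by
  have h : (sInf {l : ℕ | 0 < l ∧ qInt q l = 0}) ∈ {l : ℕ | 0 < l ∧ qInt q l = 0} := by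
    apply Nat.sInf_mem
    by_contra hne
    rw [Set.not_nonempty_iff_eq_empty] at hne
    have h3 := hq.out
    simp [qChar, hne] at h3
  exact h.2

theorem q_ne_zero : q ≠ 0 := by
  intro h
  have h2 := qInt_ne_of_lt q (k := 2) (by norm_num) (by have := hq.out; omega)
  apply h2
  simp [qInt, Finset.sum_range_succ, h]

theorem q_sub_ne_zero : q - q⁻¹ ≠ 0 := by
  intro h
  have h0 := q_ne_zero q
  have h1 : q * q = 1 := by
    have : q = q⁻¹ := sub_eq_zero.mp h
    nth_rewrite 2 [this]
    exact mul_inv_cancel₀ h0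
  have h2 : q = 1 ∨ q = -1 := mul_self_eq_one_iff.mp h1
  have h3 := qInt_qChar q
  have h4 : (qChar q : K) ≠ 0 := by
    have := hq.out
    exact_mod_cast (by omega : qChar q ≠ 0)
  have key : ∀ k : ℕ, qInt q k = k * q ^ ((k : ℤ) - 1) := by
    intro k
    have : ∀ i ∈ Finset.range k, q ^ ((k : ℤ) - 1 - 2 * (i : ℤ)) = q ^ ((k : ℤ) - 1) := by
      intro i _
      rw [zpow_sub₀ h0, zpow_mul]
      have : q ^ (2 : ℤ) = 1 := by rw [zpow_two]; exact h1
      rw [this]; simp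
    rw [qInt, Finset.sum_congr rfl this]; simp
  rw [key] at h3
  exact (mul_ne_zero h4 (zpow_ne_zero _ h0)) h3

theorem qInt_eq (k : ℕ) :
    qInt q k = (q ^ (k : ℤ) - q ^ (-(k : ℤ))) * (q - q⁻¹)⁻¹ := by
  rw [← qInt_mul_sub q (q_ne_zero q), mul_assoc, mul_inv_cancel₀ (q_sub_ne_zero q), mul_one]

theorem qInt_serre (k : ℕ) : qInt q (k + 2) + qInt q k = (q + q⁻¹) * qInt q (k + 1) := by
  have h0 := q_ne_zero q
  rw [qInt_eq, qInt_eq, qInt_eq]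
  have e1 : q ^ ((k + 2 : ℕ) : ℤ) = q ^ (k : ℤ) * q * q := by
    push_cast; rw [zpow_add₀ h0, zpow_two]; ring
  have e2 : q ^ (-((k + 2 : ℕ) : ℤ)) = q ^ (-(k : ℤ)) * q⁻¹ * q⁻¹ := by
    push_cast; rw [neg_add, zpow_add₀ h0, zpow_neg q 2, zpow_two, mul_inv]; ring
  have e3 : q ^ ((k + 1 : ℕ) : ℤ) = q ^ (k : ℤ) * q := by
    push_cast; rw [zpow_add_one₀ h0]
  have e4 : q ^ (-((k + 1 : ℕ) : ℤ)) = q ^ (-(k : ℤ)) * q⁻¹ := by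
    push_cast; rw [neg_add, zpow_add₀ h0, zpow_neg_one]
  rw [e1, e2, e3, e4]
  have : q * q⁻¹ = 1 := mul_inv_cancel₀ h0
  linear_combination ((-q ^ (k : ℤ) + q ^ (-(k : ℤ))) * (q - q⁻¹)⁻¹) * this

theorem qInt_mul_qChar (r : ℕ) : qInt q (r * qChar q) = 0 := by
  have h0 := q_ne_zero q
  have h := qInt_mul_sub q h0 (qChar q)
  rw [qInt_qChar, zero_mul] at h
  have h1 : q ^ ((qChar q : ℕ) : ℤ) = q ^ (-((qChar q : ℕ) : ℤ)) := (sub_eq_zero.mp h.symm)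
  rw [qInt_eq]
  have : q ^ ((r * qChar q : ℕ) : ℤ) = q ^ (-((r * qChar q : ℕ) : ℤ)) := by
    push_cast
    rw [mul_comm, zpow_mul, h1, ← zpow_mul]; congr 1; ring
  rw [this]; simp

theorem qInt_cross (a b : ℕ) :
    qInt q a * qInt q (b + 1) - qInt q (a + 1) * qInt q b =
      (q - q⁻¹)⁻¹ * (q ^ (a : ℤ) * q ^ (-(b : ℤ)) - q ^ (-(a : ℤ)) * q ^ (b : ℤ)) := by
  have h0 := q_ne_zero q
  have hs := q_sub_ne_zero q
  have e3 : ∀ k : ℕ, q ^ ((k + 1 : ℕ) : ℤ) = q ^ (k : ℤ) * q := fun k => by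
    push_cast; rw [zpow_add_one₀ h0]
  have e4 : ∀ k : ℕ, q ^ (-((k + 1 : ℕ) : ℤ)) = q ^ (-(k : ℤ)) * q⁻¹ := fun k => by
    push_cast; rw [neg_add, zpow_add₀ h0, zpow_neg_one]
  simp only [qInt_eq, e3, e4]
  have hs' : (q - q⁻¹) * (q - q⁻¹)⁻¹ = 1 := mul_inv_cancel₀ hs
  linear_combination ((q - q⁻¹)⁻¹ * (q ^ (a : ℤ) * q ^ (-(b : ℤ)) - q ^ (-(a : ℤ)) * q ^ (b : ℤ))) * hs'

theorem qInt_succ_sub (a : ℕ) :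
    qInt q (a + 1) = (q - q⁻¹)⁻¹ * (q ^ (a : ℤ) * q - q ^ (-(a : ℤ)) * q⁻¹) := by
  have h0 := q_ne_zero q
  rw [qInt_eq]
  push_cast
  rw [zpow_add_one₀ h0, neg_add, zpow_add₀ h0, zpow_neg_one]; ring

theorem q_pow_two_qChar : q ^ (2 * qChar q) = 1 := by
  have h0 := q_ne_zero q
  have h := qInt_mul_sub q h0 (qChar q)
  rw [qInt_qChar, zero_mul] at h
  have h1 : q ^ ((qChar q : ℕ) : ℤ) = q ^ (-((qChar q : ℕ) : ℤ)) := (sub_eq_zero.mp h.symm)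
  rw [zpow_neg, zpow_natCast] at h1
  rw [two_mul, pow_add]
  nth_rewrite 2 [h1]
  exact mul_inv_cancel₀ (pow_ne_zero _ h0)

end qNumbers

/-! ### The quantum general linear superalgebra -/

/-- Names of the generators `e_j, f_j` (`j ∈ J`) and `K_i, K_i⁻¹` (`i ∈ I`) of `U_q(gl(m|n))`.
Indices start from `0`: `I = Fin (m + n)` (the even indices are those `< m`) and
`J = Fin (m + n - 1)`; the index `m` of the odd simple root is here `j = m - 1`. -/
inductive Gen (m n : ℕ) : Type
  | e (j : Fin (m + n - 1)) : Gen m n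
  | f (j : Fin (m + n - 1)) : Gen m n
  | k (i : Fin (m + n)) : Gen m n
  | kinv (i : Fin (m + n)) : Gen m n

/-- The index `j ∈ J` as an element of `I`. -/
def lo {m n : ℕ} (j : Fin (m + n - 1)) : Fin (m + n) := ⟨j.val, by omega⟩

/-- The index `j + 1 ∈ I`, for `j ∈ J`. -/
def hi {m n : ℕ} (j : Fin (m + n - 1)) : Fin (m + n) := ⟨j.val + 1, by omega⟩

/-- The parity of `e_j` and `f_j`: odd for the simple root joining the even and the odd indices. -/
def par {m n : ℕ} (j : Fin (m + n - 1)) : ℕ := if j.val + 1 = m then 1 else 0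

section algebra
variable {K : Type*} [Field K]

/-- `q_i = q` for the even indices (`i < m`), and `q_i = q⁻¹` for the odd ones. -/
def qSite (q : K) (m i : ℕ) : K := if i < m then q else q⁻¹

variable (K) in
/-- The generator `e_j` of the free algebra. -/
def gE {m n : ℕ} (j : Fin (m + n - 1)) : FreeAlgebra K (Gen m n) := FreeAlgebra.ι K (Gen.e j)

variable (K) in
/-- The generator `f_j` of the free algebra. -/
def gF {m n : ℕ} (j : Fin (m + n - 1)) : FreeAlgebra K (Gen m n) := FreeAlgebra.ι K (Gen.f j)

variable (K) in
/-- The generator `K_i` of the free algebra. -/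
def gK {m n : ℕ} (i : Fin (m + n)) : FreeAlgebra K (Gen m n) := FreeAlgebra.ι K (Gen.k i)

variable (K) in
/-- The generator `K_i⁻¹` of the free algebra. -/
def gKinv {m n : ℕ} (i : Fin (m + n)) : FreeAlgebra K (Gen m n) := FreeAlgebra.ι K (Gen.kinv i)

/-- The defining relations of `U_q(gl(m|n))`. -/
inductive URel (q : K) (m n : ℕ) : FreeAlgebra K (Gen m n) → FreeAlgebra K (Gen m n) → Prop
  | k_comm (i j : Fin (m + n)) : URel q m n (gK K i * gK K j) (gK K j * gK K i)
  | k_kinv (i : Fin (m + n)) : URel q m n (gK K i * gKinv K i) 1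
  | kinv_k (i : Fin (m + n)) : URel q m n (gKinv K i * gK K i) 1
  | k_e (i : Fin (m + n)) (j : Fin (m + n - 1)) :
      URel q m n (gK K i * gE K j)
        (qSite q m i ^ ((if i = lo j then 1 else 0) - (if i = hi j then 1 else 0) : ℤ) •
          (gE K j * gK K i))
  | k_f (i : Fin (m + n)) (j : Fin (m + n - 1)) :
      URel q m n (gK K i * gF K j)
        (qSite q m i ^ ((if i = hi j then 1 else 0) - (if i = lo j then 1 else 0) : ℤ) •
          (gF K j * gK K i))
  | e_f_self (i : Fin (m + n - 1)) :
      URel q m n (gE K i * gF K i - (-1 : K) ^ (par i * par i) • (gF K i * gE K i))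
        ((qSite q m i - (qSite q m i)⁻¹)⁻¹ •
          (gK K (lo i) * gKinv K (hi i) - gKinv K (lo i) * gK K (hi i)))
  | e_f (i j : Fin (m + n - 1)) (h : i ≠ j) :
      URel q m n (gE K i * gF K j - (-1 : K) ^ (par i * par j) • (gF K j * gE K i)) 0
  | e_comm (i j : Fin (m + n - 1)) (h : i.val + 1 < j.val ∨ j.val + 1 < i.val) :
      URel q m n (gE K i * gE K j) (gE K j * gE K i)
  | f_comm (i j : Fin (m + n - 1)) (h : i.val + 1 < j.val ∨ j.val + 1 < i.val) :
      URel q m n (gF K i * gF K j) (gF K j * gF K i)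
  | e_serre (i j : Fin (m + n - 1)) (h : i.val + 1 = j.val ∨ j.val + 1 = i.val)
      (hm : i.val + 1 ≠ m) :
      URel q m n (gE K i ^ 2 * gE K j - (q + q⁻¹) • (gE K i * gE K j * gE K i)
        + gE K j * gE K i ^ 2) 0
  | f_serre (i j : Fin (m + n - 1)) (h : i.val + 1 = j.val ∨ j.val + 1 = i.val)
      (hm : i.val + 1 ≠ m) :
      URel q m n (gF K i ^ 2 * gF K j - (q + q⁻¹) • (gF K i * gF K j * gF K i)
        + gF K j * gF K i ^ 2) 0
  | e_sq (i : Fin (m + n - 1)) (hm : i.val + 1 = m) : URel q m n (gE K i ^ 2) 0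
  | f_sq (i : Fin (m + n - 1)) (hm : i.val + 1 = m) : URel q m n (gF K i ^ 2) 0
  | e_quartic (a b c : Fin (m + n - 1)) (hab : a.val + 1 = b.val) (hbc : b.val + 1 = c.val)
      (hm : b.val + 1 = m) :
      URel q m n (gE K a * gE K b * gE K c * gE K b + gE K b * gE K a * gE K b * gE K c
        + gE K c * gE K b * gE K a * gE K b + gE K b * gE K c * gE K b * gE K a
        - (q + q⁻¹) • (gE K b * gE K a * gE K c * gE K b)) 0
  | f_quartic (a b c : Fin (m + n - 1)) (hab : a.val + 1 = b.val) (hbc : b.val + 1 = c.val)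
      (hm : b.val + 1 = m) :
      URel q m n (gF K a * gF K b * gF K c * gF K b + gF K b * gF K a * gF K b * gF K c
        + gF K c * gF K b * gF K a * gF K b + gF K b * gF K c * gF K b * gF K a
        - (q + q⁻¹) • (gF K b * gF K a * gF K c * gF K b)) 0

/-- The quantum general linear superalgebra `U_q(gl(m|n))`. -/
def Uq (q : K) (m n : ℕ) : Type _ := RingQuot (URel q m n)

noncomputable instance (q : K) (m n : ℕ) : Ring (Uq q m n) :=
  inferInstanceAs (Ring (RingQuot (URel q m n)))

noncomputable instance (q : K) (m n : ℕ) : Algebra K (Uq q m n) :=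
  inferInstanceAs (Algebra K (RingQuot (URel q m n)))

/-- The projection from the free algebra. -/
noncomputable def Uq.mk (q : K) (m n : ℕ) : FreeAlgebra K (Gen m n) →ₐ[K] Uq q m n :=
  RingQuot.mkAlgHom K (URel q m n)

theorem Uq.mk_surjective (q : K) (m n : ℕ) : Function.Surjective (Uq.mk q m n) :=
  RingQuot.mkAlgHom_surjective K (URel q m n)

/-- The generator `e_j` of `U_q(gl(m|n))`, with `0` as value outside the range of `j`. -/
noncomputable def Uq.e (q : K) (m n j : ℕ) : Uq q m n :=
  if h : j < m + n - 1 then Uq.mk q m n (gE K ⟨j, h⟩) else 0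

/-- The generator `f_j` of `U_q(gl(m|n))`, with `0` as value outside the range of `j`. -/
noncomputable def Uq.f (q : K) (m n j : ℕ) : Uq q m n :=
  if h : j < m + n - 1 then Uq.mk q m n (gF K ⟨j, h⟩) else 0

/-- The positive root vectors `E_{i, i + d + 1}`: one has `E_{i, i + 1} = e_i` and
`E_{i, k + 1} = E_{i, k} e_k - q_k⁻¹ e_k E_{i, k}`. -/
noncomputable def Uq.rootE (q : K) (m n i : ℕ) : ℕ → Uq q m n
  | 0 => Uq.e q m n i
  | d + 1 => Uq.rootE q m n i d * Uq.e q m n (i + d + 1)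
      - (qSite q m (i + d + 1))⁻¹ • (Uq.e q m n (i + d + 1) * Uq.rootE q m n i d)

/-- The negative root vectors `F_{i + d + 1, i}`: one has `F_{i + 1, i} = f_i` and
`F_{k + 1, i} = f_k F_{k, i} - q_k F_{k, i} f_k`. -/
noncomputable def Uq.rootF (q : K) (m n i : ℕ) : ℕ → Uq q m n
  | 0 => Uq.f q m n i
  | d + 1 => Uq.f q m n (i + d + 1) * Uq.rootF q m n i d
      - qSite q m (i + d + 1) • (Uq.rootF q m n i d * Uq.f q m n (i + d + 1))

/-- The additional relations of the small quantum superalgebra, `ℓ` being the characteristic of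
`q`: the `ℓ`-th powers of the even root vectors vanish, and `K_i ^ (2 * ℓ) = 1`. -/
inductive SmallRel (q : K) (m n : ℕ) : Uq q m n → Uq q m n → Prop
  | rootE_pow (i d : ℕ) (h : i + d + 1 < m ∨ (m ≤ i ∧ i + d + 1 < m + n)) :
      SmallRel q m n (Uq.rootE q m n i d ^ qChar q) 0
  | rootF_pow (i d : ℕ) (h : i + d + 1 < m ∨ (m ≤ i ∧ i + d + 1 < m + n)) :
      SmallRel q m n (Uq.rootF q m n i d ^ qChar q) 0
  | k_pow (i : Fin (m + n)) :
      SmallRel q m n (Uq.mk q m n (gK K i) ^ (2 * qChar q)) 1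

/-- The small (restricted) quantum general linear superalgebra `u_q(gl(m|n))`. -/
def SmallUq (q : K) (m n : ℕ) : Type _ := RingQuot (SmallRel q m n)

noncomputable instance (q : K) (m n : ℕ) : Ring (SmallUq q m n) :=
  inferInstanceAs (Ring (RingQuot (SmallRel q m n)))

noncomputable instance (q : K) (m n : ℕ) : Algebra K (SmallUq q m n) :=
  inferInstanceAs (Algebra K (RingQuot (SmallRel q m n)))

/-- The projection from `U_q(gl(m|n))`. -/
noncomputable def SmallUq.mk (q : K) (m n : ℕ) : Uq q m n →ₐ[K] SmallUq q m n :=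
  RingQuot.mkAlgHom K (SmallRel q m n)

theorem SmallUq.mk_surjective (q : K) (m n : ℕ) : Function.Surjective (SmallUq.mk q m n) :=
  RingQuot.mkAlgHom_surjective K (SmallRel q m n)

end algebra

/-! ### The quantum Grassmann superalgebra as a vector space with operators -/

/-- The index set of the monomials `x^(α) ⊗ x^μ`: the pair `⟨α, μ⟩ ∈ ℕ^m × {0,1}^n` is written as
one `(m + n)`-tuple of natural numbers whose last `n` entries are at most `1`. -/
def Mon (m n : ℕ) : Type := {β : Fin (m + n) → ℕ // ∀ k, m ≤ k.val → β k ≤ 1}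

/-- The degree `|α| + |μ|` of `x^(α) ⊗ x^μ`. -/
def Mon.deg {m n : ℕ} (β : Mon m n) : ℕ := ∑ k, β.1 k

/-- The energy grade `∑ ⌊α_i / ℓ⌋` (sum over the even indices) of `x^(α) ⊗ x^μ`. -/
def Mon.energy {m n : ℕ} (l : ℕ) (β : Mon m n) : ℕ := ∑ i : Fin m, β.1 (Fin.castAdd n i) / l

/-- Lower the entry at `k` by one. -/
def Mon.lower {m n : ℕ} (β : Mon m n) (k : Fin (m + n)) : Mon m n :=
  ⟨Function.update β.1 k (β.1 k - 1), fun i hi => by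
    by_cases h : i = k
    · subst h; have := β.2 i hi; simp; omega
    · simpa [h] using β.2 i hi⟩

/-- Raise the entry at `k` by one (an odd entry is set to `1`). -/
def Mon.raise {m n : ℕ} (β : Mon m n) (k : Fin (m + n)) : Mon m n :=
  ⟨Function.update β.1 k (if k.val < m then β.1 k + 1 else 1), fun i hi => by
    by_cases h : i = k
    · subst h; simp [Nat.not_lt.mpr hi]
    · simpa [h] using β.2 i hi⟩

section space
variable {K : Type*} [Field K]

/-- The underlying vector space of the quantum Grassmann superalgebra
`Ω_q(m|n) = A_q(m) ⊗ Λ_{q⁻¹}(n)`, with the basis of the monomials `x^(α) ⊗ x^μ`. -/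
def Omega (_q : K) (m n : ℕ) : Type _ := Mon m n →₀ K

noncomputable instance (q : K) (m n : ℕ) : AddCommGroup (Omega q m n) :=
  inferInstanceAs (AddCommGroup (Mon m n →₀ K))

noncomputable instance (q : K) (m n : ℕ) : Module K (Omega q m n) :=
  inferInstanceAs (Module K (Mon m n →₀ K))

/-- The monomial basis of `Ω_q(m|n)`. -/
noncomputable def Omega.basis (q : K) (m n : ℕ) : Module.Basis (Mon m n) K (Omega q m n) :=
  Module.Basis.ofRepr (LinearEquiv.refl K (Mon m n →₀ K))

/-- The monomial `x^(α) ⊗ x^μ`. -/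
noncomputable def Omega.x (q : K) {m n : ℕ} (β : Mon m n) : Omega q m n := Omega.basis q m n β

/-- The coefficient with which a factor is created at the place `k`: `[α_k + 1]` for an even index
`k`, and `δ_{0, μ_k}` for an odd one. -/
def raiseCoeff (q : K) {m n : ℕ} (k : Fin (m + n)) (β : Mon m n) : K :=
  if k.val < m then qInt q (β.1 k + 1) else if β.1 k = 0 then 1 else 0

/-- `x^β ↦ [β_k + 1] x^(β + ε_k)`, resp. `δ_{0, β_k} x^(β + ε_k)` if `k` is odd. -/
noncomputable def opR (q : K) {m n : ℕ} (k : Fin (m + n)) : Module.End K (Omega q m n) :=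
  (Omega.basis q m n).constr K fun β => raiseCoeff q k β • Omega.x q (β.raise k)

/-- `x^β ↦ x^(β - ε_k)`, read as `0` if `β_k = 0`. -/
noncomputable def opL (q : K) {m n : ℕ} (k : Fin (m + n)) : Module.End K (Omega q m n) :=
  (Omega.basis q m n).constr K fun β => (if β.1 k = 0 then 0 else 1 : K) • Omega.x q (β.lower k)

/-- The operator `x^β ↦ c(β) x^β`. -/
noncomputable def opD (q : K) {m n : ℕ} (c : Mon m n → K) : Module.End K (Omega q m n) :=
  (Omega.basis q m n).constr K fun β => c β • Omega.x q β

/-- The action of the generators of `U_q(gl(m|n))` on the monomials: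
* `e_j` takes one factor from the place `j + 1` to the place `j`, and `f_j` one from `j` to `j + 1`
  (if there is one to take), with the coefficient of `raiseCoeff` at the place of arrival;
* `K_i` acts by `q ^ α_i` for an even index and by `q ^ (-μ_i)` for an odd one. -/
noncomputable def genAct (q : K) (m n : ℕ) : Gen m n → Module.End K (Omega q m n)
  | Gen.e j => opR q (lo j) * opL q (hi j)
  | Gen.f j => opR q (hi j) * opL q (lo j)
  | Gen.k i => opD q fun β => qSite q m i ^ β.1 i
  | Gen.kinv i => opD q fun β => (qSite q m i ^ β.1 i)⁻¹

theorem Omega.x_def (q : K) {m n : ℕ} (β : Mon m n) : Omega.basis q m n β = Omega.x q β := rfl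

theorem opR_x (q : K) {m n : ℕ} (k : Fin (m + n)) (β : Mon m n) :
    opR q k (Omega.x q β) = raiseCoeff q k β • Omega.x q (β.raise k) := by
  rw [opR, ← Omega.x_def, Module.Basis.constr_basis]

theorem opL_x (q : K) {m n : ℕ} (k : Fin (m + n)) (β : Mon m n) :
    opL q k (Omega.x q β) = (if β.1 k = 0 then 0 else 1 : K) • Omega.x q (β.lower k) := by
  rw [opL, ← Omega.x_def, Module.Basis.constr_basis]

theorem opD_x (q : K) {m n : ℕ} (c : Mon m n → K) (β : Mon m n) :
    opD q c (Omega.x q β) = c β • Omega.x q β := by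
  rw [opD, ← Omega.x_def, Module.Basis.constr_basis, Omega.x_def]

theorem end_ext (q : K) {m n : ℕ} {S T : Module.End K (Omega q m n)}
    (h : ∀ β, S (Omega.x q β) = T (Omega.x q β)) : S = T :=
  (Omega.basis q m n).ext h

theorem Mon.raise_self {m n : ℕ} (β : Mon m n) (k : Fin (m + n)) :
    (β.raise k).1 k = if k.val < m then β.1 k + 1 else 1 := by simp [Mon.raise]

theorem Mon.raise_ne {m n : ℕ} (β : Mon m n) {k i : Fin (m + n)} (h : i ≠ k) :
    (β.raise k).1 i = β.1 i := by simp [Mon.raise, h]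

theorem Mon.lower_self {m n : ℕ} (β : Mon m n) (k : Fin (m + n)) :
    (β.lower k).1 k = β.1 k - 1 := by simp [Mon.lower]

theorem Mon.lower_ne {m n : ℕ} (β : Mon m n) {k i : Fin (m + n)} (h : i ≠ k) :
    (β.lower k).1 i = β.1 i := by simp [Mon.lower, h]

theorem Mon.raise_raise {m n : ℕ} (β : Mon m n) {i k : Fin (m + n)} (h : i ≠ k) :
    (β.raise i).raise k = (β.raise k).raise i := by
  apply Subtype.ext
  simp only [Mon.raise, Function.update_of_ne h, Function.update_of_ne h.symm]
  exact Function.update_comm h _ _ _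

theorem Mon.lower_lower {m n : ℕ} (β : Mon m n) {i k : Fin (m + n)} (h : i ≠ k) :
    (β.lower i).lower k = (β.lower k).lower i := by
  apply Subtype.ext
  simp only [Mon.lower, Function.update_of_ne h, Function.update_of_ne h.symm]
  exact Function.update_comm h _ _ _

theorem Mon.raise_lower {m n : ℕ} (β : Mon m n) {i k : Fin (m + n)} (h : i ≠ k) :
    (β.raise i).lower k = (β.lower k).raise i := by
  apply Subtype.ext
  simp only [Mon.raise, Mon.lower, Function.update_of_ne h, Function.update_of_ne h.symm]
  exact Function.update_comm h _ _ _

theorem Mon.lower_raise_self {m n : ℕ} (β : Mon m n) {k : Fin (m + n)}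
    (h : k.val < m ∨ β.1 k = 0) : (β.raise k).lower k = β := by
  apply Subtype.ext
  funext i
  by_cases hi : i = k
  · subst hi; rw [Mon.lower_self, Mon.raise_self]; split_ifs <;> omega
  · rw [Mon.lower_ne _ hi, Mon.raise_ne _ hi]

theorem Mon.raise_lower_self {m n : ℕ} (β : Mon m n) {k : Fin (m + n)}
    (h : β.1 k ≠ 0) : (β.lower k).raise k = β := by
  apply Subtype.ext
  funext i
  by_cases hi : i = k
  · subst hi
    rw [Mon.raise_self, Mon.lower_self]
    have := β.2 i
    split_ifs <;> omega
  · rw [Mon.raise_ne _ hi, Mon.lower_ne _ hi]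

section comm
variable (q : K) {m n : ℕ} {i k : Fin (m + n)}

theorem opR_comm (h : i ≠ k) : Commute (opR q i) (opR q k) := by
  apply end_ext
  intro β
  simp only [Module.End.mul_apply, opR_x, map_smul, smul_smul, raiseCoeff, Mon.raise_ne _ h,
    Mon.raise_ne _ h.symm, Mon.raise_raise β h]
  rw [mul_comm]

theorem opL_comm (h : i ≠ k) : Commute (opL q i) (opL q k) := by
  apply end_ext
  intro β
  simp only [Module.End.mul_apply, opL_x, map_smul, smul_smul, Mon.lower_ne _ h,
    Mon.lower_ne _ h.symm, Mon.lower_lower β h]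
  rw [mul_comm]

theorem opR_opL_comm (h : i ≠ k) : Commute (opR q i) (opL q k) := by
  apply end_ext
  intro β
  simp only [Module.End.mul_apply, opL_x, opR_x, map_smul, smul_smul, raiseCoeff,
    Mon.lower_ne _ h, Mon.raise_ne _ h.symm, Mon.raise_lower β h]
  rw [mul_comm]

theorem opL_mul_opR (k : Fin (m + n)) : opL q k * opR q k = opD q (raiseCoeff q k) := by
  apply end_ext
  intro β
  simp only [Module.End.mul_apply, opL_x, opR_x, opD_x, map_smul, smul_smul]
  by_cases h : k.val < m ∨ β.1 k = 0
  · rw [Mon.lower_raise_self β h, Mon.raise_self]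
    congr 1
    split_ifs <;> simp_all
  · have : raiseCoeff q k β = 0 := by
      push Not at h
      rw [raiseCoeff, if_neg (Nat.not_lt.mpr h.1), if_neg h.2]
    simp [this]

/-- `[α_k]` for even `k`, and `μ_k` for odd `k`. -/
def numCoeff (q : K) {m n : ℕ} (k : Fin (m + n)) (β : Mon m n) : K :=
  if k.val < m then qInt q (β.1 k) else if β.1 k = 0 then 0 else 1

theorem opR_mul_opL (k : Fin (m + n)) : opR q k * opL q k = opD q (numCoeff q k) := by
  apply end_ext
  intro β
  simp only [Module.End.mul_apply, opL_x, opR_x, opD_x, map_smul, smul_smul]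
  by_cases h : β.1 k = 0
  · simp [numCoeff, h, qInt_zero]
  · rw [Mon.raise_lower_self β h]
    congr 1
    simp only [raiseCoeff, numCoeff, Mon.lower_self, if_neg h]
    have h1 := β.2 k
    split_ifs with h2 h3
    · rw [one_mul, Nat.sub_add_cancel (by omega)]
    · simp
    · omega

theorem opD_mul_opD (c d : Mon m n → K) : opD q c * opD q d = opD q (fun β => c β * d β) := by
  apply end_ext
  intro β
  simp only [Module.End.mul_apply, opD_x, map_smul, smul_smul]
  rw [mul_comm]

theorem opR_sq_odd (k : Fin (m + n)) (h : m ≤ k.val) : opR q k * opR q k = 0 := by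
  apply end_ext
  intro β
  simp only [Module.End.mul_apply, opR_x, map_smul, smul_smul, raiseCoeff, Mon.raise_self]
  simp [Nat.not_lt.mpr h]

theorem opL_sq_odd (k : Fin (m + n)) (h : m ≤ k.val) : opL q k * opL q k = 0 := by
  apply end_ext
  intro β
  have h1 := β.2 k h
  have h2 : β.1 k - 1 = 0 := by omega
  simp only [Module.End.mul_apply, opL_x, map_smul, Mon.lower_self, if_pos h2, zero_smul,
    smul_zero, LinearMap.zero_apply]

end comm

section serre
variable [CharZero K] (q : K) [Fact (3 ≤ qChar q)] {m n : ℕ}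

theorem site_L (k : Fin (m + n)) (h : k.val < m) :
    opL q k * opL q k * opR q k - (q + q⁻¹) • (opL q k * opR q k * opL q k)
      + opR q k * opL q k * opL q k = 0 := by
  rw [mul_assoc, opL_mul_opR, opR_mul_opL]
  apply end_ext
  intro β
  simp only [Module.End.mul_apply, LinearMap.add_apply, LinearMap.sub_apply, LinearMap.smul_apply,
    opL_x, opD_x, map_smul, smul_smul, LinearMap.zero_apply]
  rw [← sub_smul, ← add_smul]
  by_cases h0 : β.1 k = 0
  · simp [h0]
  · obtain ⟨b, hb⟩ := Nat.exists_eq_succ_of_ne_zero h0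
    simp only [raiseCoeff, numCoeff, if_pos h, Mon.lower_self, hb, if_neg (Nat.succ_ne_zero b)]
    simp only [Nat.succ_eq_add_one, Nat.add_sub_cancel]
    have := qInt_serre q b
    rw [show b + 1 + 1 = b + 2 from rfl]
    convert zero_smul K _
    linear_combination this

theorem site_R (k : Fin (m + n)) (h : k.val < m) :
    opR q k * opR q k * opL q k - (q + q⁻¹) • (opR q k * opL q k * opR q k)
      + opL q k * opR q k * opR q k = 0 := by
  rw [mul_assoc, opL_mul_opR, opR_mul_opL]
  apply end_ext
  intro β
  simp only [Module.End.mul_apply, LinearMap.add_apply, LinearMap.sub_apply, LinearMap.smul_apply,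
    opR_x, opD_x, map_smul, smul_smul, LinearMap.zero_apply]
  rw [← sub_smul, ← add_smul]
  simp only [raiseCoeff, numCoeff, if_pos h, Mon.raise_self]
  have := qInt_serre q (β.1 k)
  rw [show β.1 k + 1 + 1 = β.1 k + 2 from rfl]
  convert zero_smul K _
  linear_combination (qInt q (β.1 k + 1)) * this

theorem opR_pow_x (k : Fin (m + n)) (h : k.val < m) (t : ℕ) (β : Mon m n) :
    ∃ γ : Mon m n, γ.1 k = β.1 k + t ∧
      (opR q k ^ t) (Omega.x q β) =
        (∏ i ∈ Finset.range t, qInt q (β.1 k + i + 1)) • Omega.x q γ := by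
  induction t with
  | zero => exact ⟨β, by simp⟩
  | succ t ih =>
    obtain ⟨γ, h1, h2⟩ := ih
    refine ⟨γ.raise k, by rw [Mon.raise_self, if_pos h, h1]; rfl, ?_⟩
    rw [pow_succ', Module.End.mul_apply, h2, map_smul, opR_x, smul_smul, Finset.prod_range_succ,
      raiseCoeff, if_pos h, h1]

theorem opR_pow_qChar (k : Fin (m + n)) : opR q k ^ qChar q = 0 := by
  have h3 : 3 ≤ qChar q := Fact.out
  by_cases h : k.val < m
  · apply end_ext
    intro β
    obtain ⟨γ, -, h2⟩ := opR_pow_x q k h (qChar q) β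
    rw [h2, LinearMap.zero_apply]
    have : (∏ i ∈ Finset.range (qChar q), qInt q (β.1 k + i + 1)) = 0 := by
      have hm := Nat.mod_lt (β.1 k) (by omega : 0 < qChar q)
      apply Finset.prod_eq_zero
        (i := qChar q - 1 - β.1 k % qChar q) (Finset.mem_range.mpr (by omega))
      have e : β.1 k + (qChar q - 1 - β.1 k % qChar q) + 1 =
          (β.1 k / qChar q + 1) * qChar q := by
        have := Nat.div_add_mod' (β.1 k) (qChar q)
        rw [add_mul, one_mul]; omega
      rw [e, qInt_mul_qChar]
    rw [this, zero_smul]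
  · obtain ⟨t, ht⟩ : ∃ t, qChar q = t + 2 := ⟨qChar q - 2, by omega⟩
    rw [ht, pow_add, pow_two, opR_sq_odd q k (Nat.not_lt.mp h), mul_zero]

end serre

end space

/-! ### The operators satisfy the defining relations -/

section words
variable {K : Type*} [Field K] {A : Type*} [Ring A] [Algebra K A] {c : K}

theorem serre_word_one {r0 l1 r1 l2 : A} (h1 : Commute r0 l1) (h2 : Commute r0 r1)
    (h4 : Commute l2 l1) (h5 : Commute l2 r1) (h3 : Commute r0 l2)
    (h : r0 * r0 = 0 ∨ l1 * l1 * r1 - c • (l1 * r1 * l1) + r1 * l1 * l1 = 0) :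
    (r0 * l1) ^ 2 * (r1 * l2) - c • ((r0 * l1) * (r1 * l2) * (r0 * l1))
      + (r1 * l2) * (r0 * l1) ^ 2 = 0 := by
  have key : (r0 * l1) ^ 2 * (r1 * l2) - c • ((r0 * l1) * (r1 * l2) * (r0 * l1))
      + (r1 * l2) * (r0 * l1) ^ 2 =
      (r0 * r0) * (l1 * l1 * r1 - c • (l1 * r1 * l1) + r1 * l1 * l1) * l2 := by
    simp only [pow_two, mul_sub, sub_mul, mul_add, add_mul, mul_smul_comm, smul_mul_assoc,
      mul_assoc, h1.symm.eq, h1.symm.left_comm, h2.symm.eq, h2.symm.left_comm, h3.symm.eq,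
      h3.symm.left_comm, h4.eq, h4.left_comm, h5.eq, h5.left_comm]
  rw [key]
  rcases h with h | h <;> simp [h]

theorem serre_word_two {r0 l1 r1 l2 : A} (h1 : Commute r0 l1) (h2 : Commute r0 r1)
    (h4 : Commute l2 l1) (h5 : Commute l2 r1) (h3 : Commute r0 l2)
    (h : l2 * l2 = 0 ∨ r1 * r1 * l1 - c • (r1 * l1 * r1) + l1 * r1 * r1 = 0) :
    (r1 * l2) ^ 2 * (r0 * l1) - c • ((r1 * l2) * (r0 * l1) * (r1 * l2))
      + (r0 * l1) * (r1 * l2) ^ 2 = 0 := by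
  have key : (r1 * l2) ^ 2 * (r0 * l1) - c • ((r1 * l2) * (r0 * l1) * (r1 * l2))
      + (r0 * l1) * (r1 * l2) ^ 2 =
      r0 * (r1 * r1 * l1 - c • (r1 * l1 * r1) + l1 * r1 * r1) * (l2 * l2) := by
    simp only [pow_two, mul_sub, sub_mul, mul_add, add_mul, mul_smul_comm, smul_mul_assoc,
      mul_assoc, h1.symm.eq, h1.symm.left_comm, h2.symm.eq, h2.symm.left_comm, h3.symm.eq,
      h3.symm.left_comm, h4.eq, h4.left_comm, h5.eq, h5.left_comm]
  rw [key]
  rcases h with h | h <;> simp [h]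

theorem quartic_word {ra lb rb lc rc ld : A} (h1 : Commute ra lb) (h2 : Commute ra rb)
    (h3 : Commute ra lc) (h4 : Commute ra rc) (h5 : Commute ra ld)
    (h6 : Commute lb lc) (h7 : Commute lb rc) (h8 : Commute lb ld)
    (h9 : Commute rb lc) (h10 : Commute rb rc) (h11 : Commute rb ld)
    (h12 : Commute lc ld) (h13 : Commute rc ld) (hc : lc * lc = 0)
    (h : rb * rb * lb - c • (rb * lb * rb) + lb * rb * rb = 0) :
    (ra * lb) * (rb * lc) * (rc * ld) * (rb * lc) + (rb * lc) * (ra * lb) * (rb * lc) * (rc * ld)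
      + (rc * ld) * (rb * lc) * (ra * lb) * (rb * lc)
      + (rb * lc) * (rc * ld) * (rb * lc) * (ra * lb)
      - c • ((rb * lc) * (ra * lb) * (rc * ld) * (rb * lc)) = 0 := by
  have hc' : ∀ t, lc * (lc * t) = 0 := fun t => by rw [← mul_assoc, hc, zero_mul]
  have key : (ra * lb) * (rb * lc) * (rc * ld) * (rb * lc)
      + (rb * lc) * (ra * lb) * (rb * lc) * (rc * ld)
      + (rc * ld) * (rb * lc) * (ra * lb) * (rb * lc)
      + (rb * lc) * (rc * ld) * (rb * lc) * (ra * lb)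
      - c • ((rb * lc) * (ra * lb) * (rc * ld) * (rb * lc)) =
      ra * (rb * rb * lb - c • (rb * lb * rb) + lb * rb * rb) * (lc * rc * lc * ld) := by
    simp only [mul_sub, sub_mul, mul_add, add_mul, mul_smul_comm, smul_mul_assoc,
      mul_assoc, h1.symm.eq, h1.symm.left_comm, h2.symm.eq, h2.symm.left_comm, h3.symm.eq,
      h3.symm.left_comm, h4.symm.eq, h4.symm.left_comm, h5.symm.eq, h5.symm.left_comm,
      h6.symm.eq, h6.symm.left_comm, h7.symm.eq, h7.symm.left_comm, h8.symm.eq, h8.symm.left_comm,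
      h9.symm.eq, h9.symm.left_comm, h10.symm.eq, h10.symm.left_comm, h11.symm.eq,
      h11.symm.left_comm, h12.symm.eq, h12.symm.left_comm, h13.symm.eq, h13.symm.left_comm,
      hc, hc', mul_zero, zero_mul]
    abel
  rw [key, h, mul_zero, zero_mul]

theorem quartic_word_two {la rb lb rc lc rd : A} (h1 : Commute la lb) (h2 : Commute la rb)
    (h3 : Commute la lc) (h4 : Commute la rc) (h5 : Commute la rd)
    (h6 : Commute lb lc) (h7 : Commute lb rc) (h8 : Commute lb rd)
    (h9 : Commute rb lc) (h10 : Commute rb rc) (h11 : Commute rb rd)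
    (h12 : Commute lc rd) (h13 : Commute rc rd) (hc : rc * rc = 0)
    (h : lb * lb * rb - c • (lb * rb * lb) + rb * lb * lb = 0) :
    (rb * la) * (rc * lb) * (rd * lc) * (rc * lb) + (rc * lb) * (rb * la) * (rc * lb) * (rd * lc)
      + (rd * lc) * (rc * lb) * (rb * la) * (rc * lb)
      + (rc * lb) * (rd * lc) * (rc * lb) * (rb * la)
      - c • ((rc * lb) * (rb * la) * (rd * lc) * (rc * lb)) = 0 := by
  have hc' : ∀ t, rc * (rc * t) = 0 := fun t => by rw [← mul_assoc, hc, zero_mul]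
  have key : (rb * la) * (rc * lb) * (rd * lc) * (rc * lb)
      + (rc * lb) * (rb * la) * (rc * lb) * (rd * lc)
      + (rd * lc) * (rc * lb) * (rb * la) * (rc * lb)
      + (rc * lb) * (rd * lc) * (rc * lb) * (rb * la)
      - c • ((rc * lb) * (rb * la) * (rd * lc) * (rc * lb)) =
      la * (lb * lb * rb - c • (lb * rb * lb) + rb * lb * lb) * (rc * lc * rc * rd) := by
    simp only [mul_sub, sub_mul, mul_add, add_mul, mul_smul_comm, smul_mul_assoc,
      mul_assoc, h1.symm.eq, h1.symm.left_comm, h2.symm.eq, h2.symm.left_comm, h3.symm.eq,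
      h3.symm.left_comm, h4.symm.eq, h4.symm.left_comm, h5.symm.eq, h5.symm.left_comm,
      h6.symm.eq, h6.symm.left_comm, h7.symm.eq, h7.symm.left_comm, h8.symm.eq, h8.symm.left_comm,
      h9.symm.eq, h9.symm.left_comm, h10.symm.eq, h10.symm.left_comm, h11.symm.eq,
      h11.symm.left_comm, h12.symm.eq, h12.symm.left_comm, h13.symm.eq, h13.symm.left_comm,
      hc, hc', mul_zero, zero_mul]
    abel
  rw [key, h, mul_zero, zero_mul]

theorem commute_words {ra lb rd lc : A} (h1 : Commute ra rd) (h2 : Commute ra lc)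
    (h3 : Commute lb rd) (h4 : Commute lb lc) : Commute (ra * lb) (rd * lc) :=
  (h1.mul_right h2).mul_left (h3.mul_right h4)

end words

section relations
variable {K : Type*} [Field K] [CharZero K] (q : K) [Fact (3 ≤ qChar q)] {m n : ℕ}

theorem qSite_ne_zero (i : ℕ) : qSite q m i ≠ 0 := by
  unfold qSite
  split_ifs
  · exact q_ne_zero q
  · exact inv_ne_zero (q_ne_zero q)

theorem lo_ne_hi (j : Fin (m + n - 1)) : lo j ≠ hi j := by
  simp [lo, hi]

theorem opR_comm' (i k : Fin (m + n)) : Commute (opR q i) (opR q k) := by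
  by_cases h : i = k
  · subst h; exact Commute.refl _
  · exact opR_comm q h

theorem opL_comm' (i k : Fin (m + n)) : Commute (opL q i) (opL q k) := by
  by_cases h : i = k
  · subst h; exact Commute.refl _
  · exact opL_comm q h

theorem opK_opR (i k : Fin (m + n)) :
    (opD q fun β => qSite q m i ^ β.1 i) * opR q k =
      (if i = k then qSite q m i else 1) • (opR q k * opD q fun β => qSite q m i ^ β.1 i) := by
  apply end_ext
  intro β
  simp only [Module.End.mul_apply, LinearMap.smul_apply, opR_x, opD_x, map_smul, smul_smul]
  congr 1
  by_cases h : i = k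
  · subst h
    rw [Mon.raise_self, raiseCoeff, if_pos rfl]
    by_cases h1 : i.val < m
    · rw [if_pos h1, if_pos h1, pow_succ]; ring
    · rw [if_neg h1, if_neg h1]
      by_cases h2 : β.1 i = 0
      · rw [if_pos h2, h2]; ring
      · rw [if_neg h2]; ring
  · rw [Mon.raise_ne _ h]; simp [h]; ring

theorem opK_opL (i k : Fin (m + n)) :
    (opD q fun β => qSite q m i ^ β.1 i) * opL q k =
      (if i = k then (qSite q m i)⁻¹ else 1) •
        (opL q k * opD q fun β => qSite q m i ^ β.1 i) := by
  apply end_ext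
  intro β
  simp only [Module.End.mul_apply, LinearMap.smul_apply, opL_x, opD_x, map_smul, smul_smul]
  congr 1
  by_cases h : i = k
  · subst h
    rw [Mon.lower_self]
    by_cases h0 : β.1 i = 0
    · simp [h0]
    · obtain ⟨b, hb⟩ := Nat.exists_eq_succ_of_ne_zero h0
      simp only [hb, Nat.succ_eq_add_one, Nat.add_sub_cancel, pow_succ]
      have := qSite_ne_zero q (m := m) i
      simp
      field_simp
  · rw [Mon.lower_ne _ h]; simp [h]

theorem opK_word (i k l : Fin (m + n)) (h : k ≠ l) :
    (opD q fun β => qSite q m i ^ β.1 i) * (opR q k * opL q l) =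
      qSite q m i ^ ((if i = k then 1 else 0) - (if i = l then 1 else 0) : ℤ) •
        ((opR q k * opL q l) * opD q fun β => qSite q m i ^ β.1 i) := by
  rw [← mul_assoc, opK_opR, smul_mul_assoc, mul_assoc, opK_opL, mul_smul_comm, smul_smul,
    mul_assoc]
  congr 1
  by_cases h1 : i = k
  · subst h1; simp [h]
  · by_cases h2 : i = l
    · simp [h1, h2, h.symm]
    · simp [h1, h2]

theorem opK_opKinv (i : Fin (m + n)) :
    (opD q fun β : Mon m n => qSite q m i ^ β.1 i) *
      (opD q fun β => (qSite q m i ^ β.1 i)⁻¹) = 1 := by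
  rw [opD_mul_opD]
  apply end_ext
  intro β
  rw [opD_x, mul_inv_cancel₀ (pow_ne_zero _ (qSite_ne_zero q _)), one_smul, Module.End.one_apply]

theorem opD_comm (c d : Mon m n → K) : opD q c * opD q d = opD q d * opD q c := by
  rw [opD_mul_opD, opD_mul_opD]
  congr 1; funext β; rw [mul_comm]

theorem ef_self (j : Fin (m + n - 1)) :
    (opR q (lo j) * opL q (hi j)) * (opR q (hi j) * opL q (lo j)) -
      (-1 : K) ^ (par j * par j) •
        ((opR q (hi j) * opL q (lo j)) * (opR q (lo j) * opL q (hi j))) =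
    (qSite q m j - (qSite q m j)⁻¹)⁻¹ •
      ((opD q fun β => qSite q m (lo j) ^ β.1 (lo j)) *
          (opD q fun β => (qSite q m (hi j) ^ β.1 (hi j))⁻¹) -
        (opD q fun β => (qSite q m (lo j) ^ β.1 (lo j))⁻¹) *
          (opD q fun β => qSite q m (hi j) ^ β.1 (hi j))) := by
  have hne := lo_ne_hi j
  have e1 : (opR q (lo j) * opL q (hi j)) * (opR q (hi j) * opL q (lo j)) =
      opD q (numCoeff q (lo j)) * opD q (raiseCoeff q (hi j)) := by
    rw [← opR_mul_opL, ← opL_mul_opR]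
    have h1 := opL_comm q hne
    have h2 := opR_opL_comm q hne.symm
    simp only [mul_assoc, h1.left_comm, h1.eq, h2.left_comm, h2.eq]
  have e2 : (opR q (hi j) * opL q (lo j)) * (opR q (lo j) * opL q (hi j)) =
      opD q (numCoeff q (hi j)) * opD q (raiseCoeff q (lo j)) := by
    rw [← opR_mul_opL, ← opL_mul_opR]
    have h1 := opL_comm q hne.symm
    have h2 := opR_opL_comm q hne
    simp only [mul_assoc, h1.left_comm, h1.eq, h2.left_comm, h2.eq]
  rw [e1, e2]
  simp only [opD_mul_opD]
  apply end_ext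
  intro β
  simp only [LinearMap.sub_apply, LinearMap.smul_apply, opD_x, smul_smul]
  rw [← sub_smul, ← sub_smul, smul_smul]
  congr 1
  have hlo : (lo j).val = j.val := rfl
  have hhi : (hi j).val = j.val + 1 := rfl
  have b1 := β.2 (lo j)
  have b2 := β.2 (hi j)
  simp only [numCoeff, raiseCoeff, par, qSite, hlo, hhi] at *
  have h0 := q_ne_zero q
  have hs := q_sub_ne_zero q
  generalize β.1 (lo j) = a at *
  generalize β.1 (hi j) = b at *
  rcases lt_trichotomy (j.val + 1) m with h | h | h
  · have h' : j.val < m := by omega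
    have h'' : j.val + 1 ≠ m := by omega
    simp only [if_pos h, if_pos h', if_neg h'']
    have := qInt_cross q a b
    simp only [zpow_neg, zpow_natCast] at this
    linear_combination this
  · have h' : j.val < m := by omega
    have h'' : ¬ (j.val + 1 < m) := by omega
    simp only [if_neg h'', if_pos h', if_pos h]
    have hb : b = 0 ∨ b = 1 := by have := b2 (by omega); omega
    rcases hb with hb | hb
    · subst hb
      have := qInt_eq q a
      simp only [zpow_neg, zpow_natCast] at this
      simp [this]; ring
    · subst hb
      have := qInt_succ_sub q a
      simp only [zpow_neg, zpow_natCast] at this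
      simp [this]
  · have h1 : ¬ (j.val < m) := by omega
    have h2 : ¬ (j.val + 1 < m) := by omega
    have h3 : ¬ (j.val + 1 = m) := by omega
    simp only [if_neg h1, if_neg h2, if_neg h3]
    have ha : a = 0 ∨ a = 1 := by have := b1 (by omega); omega
    have hb : b = 0 ∨ b = 1 := by have := b2 (by omega); omega
    have hs' : q⁻¹ - q ≠ 0 := by rw [← neg_sub]; exact neg_ne_zero.mpr hs
    rcases ha with ha | ha <;> rcases hb with hb | hb <;> subst ha <;> subst hb
    · simp
    · have : (q⁻¹ - q)⁻¹ * (q⁻¹ - q) = 1 := inv_mul_cancel₀ hs'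
      simp
      linear_combination this
    · simp [inv_mul_cancel₀ hs']
    · simp [h0]

theorem genAct_rel ⦃x y : FreeAlgebra K (Gen m n)⦄ (h : URel q m n x y) :
    FreeAlgebra.lift K (genAct q m n) x = FreeAlgebra.lift K (genAct q m n) y := by
  have ne : ∀ {a b : Fin (m + n)}, a.val ≠ b.val → a ≠ b := fun h e => h (congrArg Fin.val e)
  have key : ∀ j : Fin (m + n - 1), (lo j).val = j.val ∧ (hi j).val = j.val + 1 :=
    fun j => ⟨rfl, rfl⟩
  cases h with
  | k_comm i j =>
    simp only [gK, map_mul, FreeAlgebra.lift_ι_apply, genAct]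
    exact opD_comm q _ _
  | k_kinv i =>
    simp only [gK, gKinv, map_mul, map_one, FreeAlgebra.lift_ι_apply, genAct]
    exact opK_opKinv q i
  | kinv_k i =>
    simp only [gK, gKinv, map_mul, map_one, FreeAlgebra.lift_ι_apply, genAct]
    rw [opD_comm]
    exact opK_opKinv q i
  | k_e i j =>
    simp only [gK, gE, map_mul, map_smul, FreeAlgebra.lift_ι_apply, genAct]
    exact opK_word q i _ _ (lo_ne_hi j)
  | k_f i j =>
    simp only [gK, gF, map_mul, map_smul, FreeAlgebra.lift_ι_apply, genAct]
    exact opK_word q i _ _ (lo_ne_hi j).symm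
  | e_f_self j =>
    simp only [gK, gE, gF, gKinv, map_mul, map_smul, map_sub, FreeAlgebra.lift_ι_apply, genAct]
    exact ef_self q j
  | e_f i j h =>
    simp only [gE, gF, map_mul, map_smul, map_sub, map_zero, FreeAlgebra.lift_ι_apply, genAct]
    have hp : par i * par j = 0 := by
      unfold par
      have : i.val ≠ j.val := fun e => h (Fin.ext e)
      split_ifs <;> first | omega | simp
    have hij : i.val ≠ j.val := fun e => h (Fin.ext e)
    rw [hp, pow_zero, one_smul, sub_eq_zero]
    refine commute_words (opR_comm' q _ _) (opR_opL_comm q (ne ?_))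
      (opR_opL_comm q (ne ?_)).symm (opL_comm' q _ _)
    · exact hij
    · rw [(key i).2, (key j).2]; omega
  | e_comm i j h =>
    simp only [gE, map_mul, FreeAlgebra.lift_ι_apply, genAct]
    refine commute_words (opR_comm' q _ _) (opR_opL_comm q (ne ?_))
      (opR_opL_comm q (ne ?_)).symm (opL_comm' q _ _)
    · rw [(key i).1, (key j).2]; omega
    · rw [(key i).2, (key j).1]; omega
  | f_comm i j h =>
    simp only [gF, map_mul, FreeAlgebra.lift_ι_apply, genAct]
    refine commute_words (opR_comm' q _ _) (opR_opL_comm q (ne ?_))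
      (opR_opL_comm q (ne ?_)).symm (opL_comm' q _ _)
    · rw [(key i).2, (key j).1]; omega
    · rw [(key i).1, (key j).2]; omega
  | e_serre i j h hm =>
    simp only [gE, map_mul, map_smul, map_sub, map_add, map_pow, map_zero,
      FreeAlgebra.lift_ι_apply, genAct]
    rcases h with h | h
    · have e : hi i = lo j := Fin.ext h
      rw [e]
      have n1 : lo i ≠ lo j := ne (by rw [(key i).1, (key j).1]; omega)
      have n2 : lo i ≠ hi j := ne (by rw [(key i).1, (key j).2]; omega)
      have n3 := lo_ne_hi j
      refine serre_word_one (opR_opL_comm q n1) (opR_comm q n1) (opL_comm q n3.symm)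
        (opR_opL_comm q n3).symm (opR_opL_comm q n2) ?_
      by_cases hc : (lo j).val < m
      · exact Or.inr (site_L q _ hc)
      · rw [(key j).1] at hc
        exact Or.inl (opR_sq_odd q _ (by rw [(key i).1]; omega))
    · have e : hi j = lo i := Fin.ext h
      rw [e]
      have n1 : lo j ≠ lo i := ne (by rw [(key i).1, (key j).1]; omega)
      have n2 : lo j ≠ hi i := ne (by rw [(key i).2, (key j).1]; omega)
      have n3 := lo_ne_hi i
      refine serre_word_two (opR_opL_comm q n1) (opR_comm q n1) (opL_comm q n3.symm)
        (opR_opL_comm q n3).symm (opR_opL_comm q n2) ?_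
      by_cases hc : (lo i).val < m
      · exact Or.inr (site_R q _ hc)
      · rw [(key i).1] at hc
        exact Or.inl (opL_sq_odd q _ (by rw [(key i).2]; omega))
  | f_serre i j h hm =>
    simp only [gF, map_mul, map_smul, map_sub, map_add, map_pow, map_zero,
      FreeAlgebra.lift_ι_apply, genAct]
    rcases h with h | h
    · have e : hi i = lo j := Fin.ext h
      rw [e]
      have n1 : hi j ≠ lo j := (lo_ne_hi j).symm
      have n2 : hi j ≠ lo i := ne (by rw [(key i).1, (key j).2]; omega)
      have n3 : lo i ≠ lo j := ne (by rw [(key i).1, (key j).1]; omega)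
      refine serre_word_two (opR_opL_comm q n1) (opR_comm q n1) (opL_comm q n3)
        (opR_opL_comm q n3.symm).symm (opR_opL_comm q n2) ?_
      by_cases hc : (lo j).val < m
      · exact Or.inr (site_R q _ hc)
      · rw [(key j).1] at hc
        exact Or.inl (opL_sq_odd q _ (by rw [(key i).1]; omega))
    · have e : hi j = lo i := Fin.ext h
      rw [e]
      have n1 : hi i ≠ lo i := (lo_ne_hi i).symm
      have n2 : hi i ≠ lo j := ne (by rw [(key i).2, (key j).1]; omega)
      have n3 : lo j ≠ lo i := ne (by rw [(key i).1, (key j).1]; omega)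
      refine serre_word_one (opR_opL_comm q n1) (opR_comm q n1) (opL_comm q n3)
        (opR_opL_comm q n3.symm).symm (opR_opL_comm q n2) ?_
      by_cases hc : (lo i).val < m
      · exact Or.inr (site_L q _ hc)
      · rw [(key i).1] at hc
        exact Or.inl (opR_sq_odd q _ (by rw [(key i).2]; omega))
  | e_sq i hm =>
    simp only [gE, map_pow, map_zero, FreeAlgebra.lift_ι_apply, genAct]
    rw [(opR_opL_comm q (lo_ne_hi i)).mul_pow, pow_two (opL q (hi i)),
      opL_sq_odd q _ (by rw [(key i).2]; omega), mul_zero]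
  | f_sq i hm =>
    simp only [gF, map_pow, map_zero, FreeAlgebra.lift_ι_apply, genAct]
    rw [(opR_opL_comm q (lo_ne_hi i).symm).mul_pow, pow_two (opR q (hi i)),
      opR_sq_odd q _ (by rw [(key i).2]; omega), zero_mul]
  | e_quartic a b c hab hbc hm =>
    simp only [gE, map_mul, map_smul, map_sub, map_add, map_zero,
      FreeAlgebra.lift_ι_apply, genAct]
    have e1 : hi a = lo b := Fin.ext hab
    have e2 : hi b = lo c := Fin.ext hbc
    rw [e1, e2]
    have n1 : lo a ≠ lo b := ne (by rw [(key a).1, (key b).1]; omega)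
    have n2 : lo a ≠ lo c := ne (by rw [(key a).1, (key c).1]; omega)
    have n3 : lo a ≠ hi c := ne (by rw [(key a).1, (key c).2]; omega)
    have n4 : lo b ≠ lo c := ne (by rw [(key b).1, (key c).1]; omega)
    have n5 : lo b ≠ hi c := ne (by rw [(key b).1, (key c).2]; omega)
    have n6 := lo_ne_hi c
    exact quartic_word (opR_opL_comm q n1) (opR_comm q n1) (opR_opL_comm q n2) (opR_comm q n2)
      (opR_opL_comm q n3) (opL_comm q n4) (opR_opL_comm q n4.symm).symm (opL_comm q n5)
      (opR_opL_comm q n4) (opR_comm q n4) (opR_opL_comm q n5) (opL_comm q n6)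
      (opR_opL_comm q n6) (opL_sq_odd q _ (by rw [(key c).1]; omega))
      (site_R q _ (by rw [(key b).1]; omega))
  | f_quartic a b c hab hbc hm =>
    simp only [gF, map_mul, map_smul, map_sub, map_add, map_zero,
      FreeAlgebra.lift_ι_apply, genAct]
    have e1 : hi a = lo b := Fin.ext hab
    have e2 : hi b = lo c := Fin.ext hbc
    rw [e1, e2]
    have n1 : lo a ≠ lo b := ne (by rw [(key a).1, (key b).1]; omega)
    have n2 : lo a ≠ lo c := ne (by rw [(key a).1, (key c).1]; omega)
    have n3 : lo a ≠ hi c := ne (by rw [(key a).1, (key c).2]; omega)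
    have n4 : lo b ≠ lo c := ne (by rw [(key b).1, (key c).1]; omega)
    have n5 : lo b ≠ hi c := ne (by rw [(key b).1, (key c).2]; omega)
    have n6 := lo_ne_hi c
    exact quartic_word_two (opL_comm q n1) (opR_opL_comm q n1.symm).symm (opL_comm q n2)
      (opR_opL_comm q n2.symm).symm (opR_opL_comm q n3.symm).symm (opL_comm q n4)
      (opR_opL_comm q n4.symm).symm (opR_opL_comm q n5.symm).symm
      (opR_opL_comm q n4) (opR_comm q n4) (opR_comm q n5) (opR_opL_comm q n6.symm).symm
      (opR_comm q n6) (opR_sq_odd q _ (by rw [(key c).1]; omega))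
      (site_L q _ (by rw [(key b).1]; omega))

end relations

section action
variable {K : Type*} [Field K] [CharZero K] (q : K) [Fact (3 ≤ qChar q)] (m n : ℕ)

/-- The representation of `U_q(gl(m|n))` on `Ω_q(m|n)`. -/
noncomputable def Uq.act : Uq q m n →ₐ[K] Module.End K (Omega q m n) :=
  RingQuot.liftAlgHom K ⟨FreeAlgebra.lift K (genAct q m n), genAct_rel q⟩

theorem Uq.act_mk (x : FreeAlgebra K (Gen m n)) :
    Uq.act q m n (Uq.mk q m n x) = FreeAlgebra.lift K (genAct q m n) x :=
  RingQuot.liftAlgHom_mkAlgHom_apply K _ _ _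

theorem Uq.act_e (j : ℕ) (h : j < m + n - 1) :
    Uq.act q m n (Uq.e q m n j) = opR q (lo ⟨j, h⟩) * opL q (hi ⟨j, h⟩) := by
  rw [Uq.e, dif_pos h, Uq.act_mk, gE, FreeAlgebra.lift_ι_apply, genAct]

theorem Uq.act_f (j : ℕ) (h : j < m + n - 1) :
    Uq.act q m n (Uq.f q m n j) = opR q (hi ⟨j, h⟩) * opL q (lo ⟨j, h⟩) := by
  rw [Uq.f, dif_pos h, Uq.act_mk, gF, FreeAlgebra.lift_ι_apply, genAct]

theorem Uq.act_rootE (i d : ℕ) (h : i + d + 1 < m + n) :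
    ∃ S : Module.End K (Omega q m n), Commute (opR q ⟨i, by omega⟩) S ∧
      Uq.act q m n (Uq.rootE q m n i d) = opR q ⟨i, by omega⟩ * S := by
  induction d with
  | zero =>
    refine ⟨_, opR_opL_comm q ?_, Uq.act_e q m n i (by omega)⟩
    exact lo_ne_hi (m := m) (n := n) ⟨i, by omega⟩
  | succ d ih =>
    obtain ⟨S, h1, h2⟩ := ih (by omega)
    have hj : i + d + 1 < m + n - 1 := by omega
    have hc : Commute (opR q ⟨i, by omega⟩) (Uq.act q m n (Uq.e q m n (i + d + 1))) := by
      rw [Uq.act_e q m n _ hj]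
      refine (opR_comm' q _ _).mul_right (opR_opL_comm q fun e => ?_)
      have := congrArg Fin.val e
      simp only [hi] at this
      omega
    refine ⟨S * Uq.act q m n (Uq.e q m n (i + d + 1)) - (qSite q m (i + d + 1))⁻¹ •
      (Uq.act q m n (Uq.e q m n (i + d + 1)) * S), ?_, ?_⟩
    · exact (h1.mul_right hc).sub_right ((hc.mul_right h1).smul_right _)
    · rw [Uq.rootE, map_sub, map_smul, map_mul, map_mul, h2, mul_sub, mul_smul_comm, mul_assoc,
        ← mul_assoc _ (opR q _) S, ← hc.eq, mul_assoc]

theorem Uq.act_rootF_comm (i d : ℕ) (h : i + d + 1 < m + n) (k : Fin (m + n))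
    (hk : i + d + 1 < k.val) : Commute (opR q k) (Uq.act q m n (Uq.rootF q m n i d)) := by
  have hf : ∀ j, i + d + 1 > j → Commute (opR q k) (Uq.act q m n (Uq.f q m n j)) := by
    intro j hj
    rw [Uq.act_f q m n j (by omega)]
    refine (opR_comm' q _ _).mul_right (opR_opL_comm q fun e => ?_)
    have := congrArg Fin.val e
    simp only [lo] at this
    omega
  induction d with
  | zero => exact hf i (by omega)
  | succ d ih =>
    have h1 := ih (by omega) (by omega) (fun j hj => hf j (by omega))
    have h2 := hf (i + d + 1) (by omega)
    rw [Uq.rootF, map_sub, map_smul, map_mul, map_mul]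
    exact (h2.mul_right h1).sub_right ((h1.mul_right h2).smul_right _)

theorem Uq.act_rootF (i d : ℕ) (h : i + d + 1 < m + n) :
    ∃ S : Module.End K (Omega q m n), Commute (opR q ⟨i + d + 1, h⟩) S ∧
      Uq.act q m n (Uq.rootF q m n i d) = opR q ⟨i + d + 1, h⟩ * S := by
  cases d with
  | zero =>
    refine ⟨_, opR_opL_comm q ?_, Uq.act_f q m n i (by omega)⟩
    exact (lo_ne_hi (m := m) (n := n) ⟨i, by omega⟩).symm
  | succ d =>
    have hj : i + d + 1 < m + n - 1 := by omega
    have h1 := Uq.act_rootF_comm q m n i d (by omega) ⟨i + (d + 1) + 1, h⟩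
      (show i + d + 1 < i + (d + 1) + 1 by omega)
    have h2 : Commute (opR q ⟨i + (d + 1) + 1, h⟩)
        (opL q (lo (m := m) (n := n) ⟨i + d + 1, hj⟩)) :=
      opR_opL_comm q (lo_ne_hi (m := m) (n := n) ⟨i + d + 1, hj⟩).symm
    refine ⟨opL q (lo ⟨i + d + 1, hj⟩) * Uq.act q m n (Uq.rootF q m n i d) -
      qSite q m (i + d + 1) • (Uq.act q m n (Uq.rootF q m n i d) * opL q (lo ⟨i + d + 1, hj⟩)),
      (h2.mul_right h1).sub_right ((h1.mul_right h2).smul_right _), ?_⟩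
    rw [Uq.rootF, map_sub, map_smul, map_mul, map_mul, Uq.act_f q m n _ hj]
    have e : hi (m := m) (n := n) ⟨i + d + 1, hj⟩ = ⟨i + (d + 1) + 1, h⟩ := rfl
    rw [e, mul_sub, mul_smul_comm, mul_assoc, ← mul_assoc _ (opR q _) (opL q _), ← h1.eq,
      mul_assoc]

theorem Uq.act_k (i : Fin (m + n)) : Uq.act q m n (Uq.mk q m n (gK K i)) =
    opD q fun β => qSite q m i ^ β.1 i := by
  rw [Uq.act_mk, gK, FreeAlgebra.lift_ι_apply, genAct]

theorem opD_pow_x (c : Mon m n → K) (t : ℕ) (β : Mon m n) :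
    (opD q c ^ t) (Omega.x q β) = c β ^ t • Omega.x q β := by
  induction t with
  | zero => simp
  | succ t ih =>
    rw [pow_succ', Module.End.mul_apply, ih, map_smul, opD_x, smul_smul, pow_succ]

theorem Uq.act_small ⦃x y : Uq q m n⦄ (h : SmallRel q m n x y) :
    Uq.act q m n x = Uq.act q m n y := by
  cases h with
  | rootE_pow i d h =>
    obtain ⟨S, h1, h2⟩ := Uq.act_rootE q m n i d (by omega)
    rw [map_pow, h2, h1.mul_pow, opR_pow_qChar, zero_mul, map_zero]
  | rootF_pow i d h =>
    obtain ⟨S, h1, h2⟩ := Uq.act_rootF q m n i d (by omega)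
    rw [map_pow, h2, h1.mul_pow, opR_pow_qChar, zero_mul, map_zero]
  | k_pow i =>
    rw [map_pow, map_one, Uq.act_k]
    apply end_ext
    intro β
    have : qSite q m i ^ (2 * qChar q) = 1 := by
      unfold qSite
      split_ifs
      · exact q_pow_two_qChar q
      · rw [inv_pow, q_pow_two_qChar q, inv_one]
    rw [opD_pow_x, ← pow_mul, mul_comm, pow_mul, this, one_pow, one_smul, Module.End.one_apply]

/-- The representation of the small quantum superalgebra `u_q(gl(m|n))` on `Ω_q(m|n)`. -/
noncomputable def SmallUq.act : SmallUq q m n →ₐ[K] Module.End K (Omega q m n) :=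
  RingQuot.liftAlgHom K ⟨Uq.act q m n, Uq.act_small q m n⟩

theorem SmallUq.act_mk (x : Uq q m n) :
    SmallUq.act q m n (SmallUq.mk q m n x) = Uq.act q m n x :=
  RingQuot.liftAlgHom_mkAlgHom_apply K _ _ _

/-- `Ω_q(m|n)` as a `U_q(gl(m|n))`-module. -/
noncomputable instance : Module (Uq q m n) (Omega q m n) :=
  Module.compHom (Omega q m n) (Uq.act q m n).toRingHom

/-- `Ω_q(m|n)` as a `u_q(gl(m|n))`-module. -/
noncomputable instance : Module (SmallUq q m n) (Omega q m n) :=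
  Module.compHom (Omega q m n) (SmallUq.act q m n).toRingHom

theorem Uq.smul_def (u : Uq q m n) (y : Omega q m n) : u • y = Uq.act q m n u y := rfl

theorem SmallUq.smul_def (u : SmallUq q m n) (y : Omega q m n) :
    u • y = SmallUq.act q m n u y := rfl

end action

/-! ### Truncations, energy grades -/

section truncated
variable {K : Type*} [Field K]

/-- The index set of the monomials of degree `s` whose even exponents are at most `r * ℓ - 1`,
where `ℓ` is the characteristic of `q`. -/
def monTrunc (q : K) (m n r s : ℕ) : Set (Mon m n) :=
  {β | β.deg = s ∧ ∀ k, k.val < m → β.1 k < r * qChar q}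

/-- The space `Ω_q^(s)(m|n, 𝐫)`, with `𝐫 = (r * ℓ - 1, …, r * ℓ - 1)`. -/
noncomputable def OmegaTrunc (q : K) (m n r s : ℕ) : Submodule K (Omega q m n) :=
  Submodule.span K (Omega.x q '' monTrunc q m n r s)

/-- The energy grade of an element of `Ω_q(m|n)`: the largest energy grade of a monomial that
occurs in it. -/
noncomputable def Edeg (q : K) {m n : ℕ} (y : Omega q m n) : ℕ :=
  ((Omega.basis q m n).repr y).support.sup (Mon.energy (qChar q))

/-- The lowest energy grade `E₀(s)` of the (nonzero) elements of `Ω_q^(s)(m|n, 𝐫)`. -/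
noncomputable def lowEnergy (q : K) (m n r s : ℕ) : ℕ :=
  sInf {t : ℕ | ∃ y ∈ OmegaTrunc q m n r s, y ≠ 0 ∧ Edeg q y = t}

/-- The highest energy grade `E(s)` of the (nonzero) elements of `Ω_q^(s)(m|n, 𝐫)`. -/
noncomputable def highEnergy (q : K) (m n r s : ℕ) : ℕ :=
  sSup {t : ℕ | ∃ y ∈ OmegaTrunc q m n r s, y ≠ 0 ∧ Edeg q y = t}

/-- The `i`-th term `𝒱_i` of the energy filtration of `Ω_q^(s)(m|n, 𝐫)`: the span of the monomials
of energy grade between `E₀(s)` and `E₀(s) + i`. -/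
noncomputable def energyFiltration (q : K) (m n r s i : ℕ) : Submodule K (Omega q m n) :=
  Submodule.span K (Omega.x q '' {β | β ∈ monTrunc q m n r s ∧
    lowEnergy q m n r s ≤ β.energy (qChar q) ∧
    β.energy (qChar q) ≤ lowEnergy q m n r s + i})

theorem Mon.deg_raise {m n : ℕ} (β : Mon m n) (k : Fin (m + n)) (h : k.val < m ∨ β.1 k = 0) :
    (β.raise k).deg = β.deg + 1 := by
  have h1 := Finset.add_sum_erase Finset.univ β.1 (Finset.mem_univ k)
  have h2 := Finset.add_sum_erase Finset.univ (β.raise k).1 (Finset.mem_univ k)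
  have h3 : ∑ x ∈ Finset.univ.erase k, (β.raise k).1 x = ∑ x ∈ Finset.univ.erase k, β.1 x :=
    Finset.sum_congr rfl fun x hx => Mon.raise_ne β (Finset.ne_of_mem_erase hx)
  have h4 : (β.raise k).1 k = β.1 k + 1 := by
    rw [Mon.raise_self]; split_ifs with h5
    · rfl
    · rw [h.resolve_left h5]
  unfold Mon.deg
  omega

theorem Mon.deg_lower {m n : ℕ} (β : Mon m n) (k : Fin (m + n)) (h : β.1 k ≠ 0) :
    (β.lower k).deg + 1 = β.deg := by
  have h1 := Finset.add_sum_erase Finset.univ β.1 (Finset.mem_univ k)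
  have h2 := Finset.add_sum_erase Finset.univ (β.lower k).1 (Finset.mem_univ k)
  have h3 : ∑ x ∈ Finset.univ.erase k, (β.lower k).1 x = ∑ x ∈ Finset.univ.erase k, β.1 x :=
    Finset.sum_congr rfl fun x hx => Mon.lower_ne β (Finset.ne_of_mem_erase hx)
  have h4 := Mon.lower_self β k
  unfold Mon.deg
  omega

variable [CharZero K] (q : K) [Fact (3 ≤ qChar q)] (m n r s : ℕ)

theorem word_mem {k l : Fin (m + n)} (hkl : k ≠ l) {β : Mon m n} (hβ : β ∈ monTrunc q m n r s) :
    (opR q k * opL q l) (Omega.x q β) ∈ OmegaTrunc q m n r s := by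
  rw [Module.End.mul_apply, opL_x, map_smul, opR_x, smul_smul]
  by_cases h0 : β.1 l = 0
  · simp [h0]
  by_cases h1 : raiseCoeff q k (β.lower l) = 0
  · simp [h1]
  refine Submodule.smul_mem _ _ (Submodule.subset_span ⟨_, ⟨?_, ?_⟩, rfl⟩)
  · rw [Mon.deg_raise, Mon.deg_lower β l h0, hβ.1]
    by_contra h2
    push Not at h2
    exact h1 (by rw [raiseCoeff, if_neg (Nat.not_lt.mpr h2.1), if_neg h2.2])
  · intro i hi
    have hb := hβ.2 i hi
    by_cases hik : i = k
    · subst hik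
      rw [Mon.raise_self, if_pos hi, Mon.lower_ne β hkl]
      rw [raiseCoeff, if_pos hi, Mon.lower_ne β hkl] at h1
      have : β.1 i + 1 ≠ r * qChar q := fun e => h1 (by rw [e, qInt_mul_qChar])
      omega
    · rw [Mon.raise_ne _ hik]
      by_cases hil : i = l
      · subst hil; rw [Mon.lower_self]; omega
      · rw [Mon.lower_ne _ hil]; exact hb

theorem genAct_mem (g : Gen m n) {y : Omega q m n} (hy : y ∈ OmegaTrunc q m n r s) :
    genAct q m n g y ∈ OmegaTrunc q m n r s := by
  induction hy using Submodule.span_induction with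
  | mem x hx =>
    obtain ⟨β, hβ, rfl⟩ := hx
    cases g with
    | e j => exact word_mem q m n r s (lo_ne_hi j) hβ
    | f j => exact word_mem q m n r s (lo_ne_hi j).symm hβ
    | k i =>
      simp only [genAct]
      rw [opD_x]
      exact Submodule.smul_mem _ _ (Submodule.subset_span ⟨_, hβ, rfl⟩)
    | kinv i =>
      simp only [genAct]
      rw [opD_x]
      exact Submodule.smul_mem _ _ (Submodule.subset_span ⟨_, hβ, rfl⟩)
  | zero => rw [map_zero]; exact Submodule.zero_mem _
  | add x y _ _ hx hy => rw [map_add]; exact Submodule.add_mem _ hx hy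
  | smul a x _ hx => rw [map_smul]; exact Submodule.smul_mem _ _ hx

theorem Uq.act_mem (u : Uq q m n) {y : Omega q m n} (hy : y ∈ OmegaTrunc q m n r s) :
    Uq.act q m n u y ∈ OmegaTrunc q m n r s := by
  obtain ⟨w, rfl⟩ := Uq.mk_surjective q m n u
  rw [Uq.act_mk]
  induction w using FreeAlgebra.induction generalizing y with
  | grade0 c =>
    rw [AlgHom.commutes, Module.algebraMap_end_apply]
    exact Submodule.smul_mem _ _ hy
  | grade1 g => rw [FreeAlgebra.lift_ι_apply]; exact genAct_mem q m n r s g hy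
  | mul a b ha hb => rw [map_mul, Module.End.mul_apply]; exact ha (hb hy)
  | add a b ha hb => rw [map_add, LinearMap.add_apply]; exact Submodule.add_mem _ (ha hy) (hb hy)

/-- `Ω_q^(s)(m|n, 𝐫)` as a `U_q(gl(m|n))`-submodule of `Ω_q(m|n)`. -/
noncomputable def Uq.truncModule : Submodule (Uq q m n) (Omega q m n) where
  carrier := OmegaTrunc q m n r s
  add_mem' := Submodule.add_mem _
  zero_mem' := Submodule.zero_mem _
  smul_mem' u _ hy := Uq.act_mem q m n r s u hy

/-- `Ω_q^(s)(m|n, 𝐫)` as a `u_q(gl(m|n))`-submodule of `Ω_q(m|n)`. -/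
noncomputable def SmallUq.truncModule : Submodule (SmallUq q m n) (Omega q m n) where
  carrier := OmegaTrunc q m n r s
  add_mem' := Submodule.add_mem _
  zero_mem' := Submodule.zero_mem _
  smul_mem' u y hy := by
    obtain ⟨w, rfl⟩ := SmallUq.mk_surjective q m n u
    rw [SmallUq.smul_def, SmallUq.act_mk]
    exact Uq.act_mem q m n r s w hy

end truncated

/-! ### Loewy filtrations -/

section loewy
variable (A : Type*) [Ring A] (M : Type*) [AddCommGroup M] [Module A M]

/-- The socle of a module: the sum of its simple submodules. -/
def socle : Submodule A M := sSup {N : Submodule A M | IsSimpleModule A N}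

/-- The socle filtration: `Soc⁰ M = 0`, and `Soc^(k+1) M / Soc^k M` is the socle of
`M / Soc^k M`. -/
def socleFiltration : ℕ → Submodule A M
  | 0 => ⊥
  | k + 1 => (socle A (M ⧸ socleFiltration k)).comap (socleFiltration k).mkQ

/-- The radical filtration: `Rad⁰ M = M`, and `Rad^(k+1) M` is the radical (the intersection of the
maximal submodules) of `Rad^k M`. -/
def radicalFiltration : ℕ → Submodule A M
  | 0 => ⊤
  | k + 1 => (Module.jacobson A (radicalFiltration k)).map (radicalFiltration k).subtype

/-- An increasing filtration `0 = F 0 ⊆ F 1 ⊆ ⋯ ⊆ F t = M` of length `t` with semisimple successive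
quotients. -/
structure IsSemisimpleFiltration (t : ℕ) (F : ℕ → Submodule A M) : Prop where
  mono : Monotone F
  zero : F 0 = ⊥
  top : F t = ⊤
  semisimple : ∀ i < t, IsSemisimpleModule A (F (i + 1) ⧸ (F i).submoduleOf (F (i + 1)))

/-- The Loewy length of a module: the least length of a filtration with semisimple successive
quotients (for a module which has one). -/
noncomputable def loewyLength : ℕ := sInf {t : ℕ | ∃ F, IsSemisimpleFiltration A M t F}

/-- A module is rigid if it has a filtration with semisimple quotients and its socle and radical
filtrations coincide, i.e. `Rad^(t-k) M = Soc^k M` for `0 ≤ k ≤ t`, where `t` is the Loewy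
length. -/
def IsRigid : Prop :=
  (∃ t F, IsSemisimpleFiltration A M t F) ∧
    ∀ k ≤ loewyLength A M, radicalFiltration A M (loewyLength A M - k) = socleFiltration A M k

end loewy

end QGrass

/-! Let ℓ be the characteristic of q and write every exponent as β_k = a_k + ℓκ_k. The residue a_k
is at most ℓ-1 at an even place and at most 1 at an odd place, where κ_k = 0. The energy grade is
Σκ_k and the degree is Σa_k + ℓΣκ_k, so in a fixed degree the residues determine the energy. Each
e_j or f_j moves one unit between neighbouring places. Since [j] = 0 exactly when ℓ divides j, its
coefficient is nonzero only if the residue at the place of arrival is below its bound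
(`raiseCoeff_ne_zero_iff`). Hence no carry ever occurs on arrival, while a departure from residue 0
borrows from the quotient. Quotients never grow, and the energy filtration consists of submodules.

Three families of operators in the image of the algebra control everything. Lagrange interpolation
in the K_i² projects onto the monomials with given residues (`exists_projection`). Products of moves
rearrange the residues arbitrarily, subject to their bounds and their sum, without touching the
quotients (`reach_of_sum_eq`). If the residues have room for ℓ more units, one unit of κ_i can be
turned into ℓ units of residue, while monomials with κ_i = 0 are killed (`drop_of_sum_eq`). The last
two act in the same way on all monomials with the same residues, so they can be applied to linear
combinations without cancellation.

It follows that modulo lower energy each monomial generates a simple module (`exists_map_map_x_eq`),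
so the layers are semisimple. A submodule with an element of large energy has one in every lower
layer, down to the bottom (`IsQuantumAction.exists_mem_energyLt_succ`), so no layer can be skipped
by the socle. Every monomial below the top energy is obtained from one of the next energy
(`exists_map_eq_x`), so a submodule that covers a layer contains all that lies below
(`IsQuantumAction.energyLt_le`), which bounds the radical from below.

These are the conditions of an abstract criterion, `IsLoewyFiltration`: a filtration that satisfies
them is the socle filtration and, reversed, the radical filtration, and its length is the Loewy
length. Only the image of the algebra in the endomorphisms matters, so u_q and U_q are treated
together through `IsQuantumAction`. -/

namespace QGrass

/-! ### A criterion for rigidity of modules over a ring -/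

section loewyCriterion
variable {A : Type*} [Ring A] {M : Type*} [AddCommGroup M] [Module A M]

theorem le_socle_of_isSemisimpleModule (P : Submodule A M) [IsSemisimpleModule A P] :
    P ≤ socle A M := by
  have h := congrArg (Submodule.map P.subtype) (IsSemisimpleModule.sSup_simples_eq_top A P)
  rw [Submodule.map_top, Submodule.range_subtype, sSup_eq_iSup, Submodule.map_iSup] at h
  rw [← h]
  refine iSup_le fun S => ?_
  rw [Submodule.map_iSup]
  refine iSup_le fun hS => le_sSup ?_
  have : IsSimpleModule A S := hS
  exact IsSimpleModule.congr (Submodule.equivMapOfInjective _ P.subtype_injective S).symm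

/-- If `V` is generated, over `U`, by elements which can be recovered, up to `U`, from each of their
multiples outside of `U`, then the image of `V` in `M / U` is semisimple. -/
theorem isSemisimpleModule_map_mkQ {U V : Submodule A M} {G : Set M}
    (hV : V = U ⊔ Submodule.span A G)
    (hG : ∀ g ∈ G, ∀ a : A, a • g ∈ U ∨ ∃ b : A, b • a • g - g ∈ U) :
    IsSemisimpleModule A (V.map U.mkQ) := by
  have h : V.map U.mkQ = ⨆ g ∈ G, Submodule.span A {U.mkQ g} := by
    rw [hV, Submodule.map_sup, Submodule.mkQ_map_self, bot_sup_eq, Submodule.map_span,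
      ← Set.biUnion_of_singleton (U.mkQ '' G), Submodule.span_iUnion₂, iSup_image]
  rw [h]
  apply isSemisimpleModule_biSup_of_isSemisimpleModule_submodule
  intro g hg
  by_cases h0 : U.mkQ g = 0
  -- A generator may lie in U; its class then spans the zero module, which is semisimple but not
  -- simple.
  · rw [h0, Submodule.span_zero_singleton]
    exact IsSemisimpleModule.of_sSup_simples_eq_top (Subsingleton.elim _ _)
  · have : IsSimpleModule A (Submodule.span A {U.mkQ g}) := by
      rw [isSimpleModule_iff_isAtom]
      refine ⟨by rwa [Ne, Submodule.span_singleton_eq_bot], fun N hN => ?_⟩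
      by_contra hb
      obtain ⟨y, hy, hy0⟩ := Submodule.exists_mem_ne_zero_of_ne_bot hb
      obtain ⟨a, rfl⟩ := Submodule.mem_span_singleton.mp (hN.le hy)
      refine hN.not_ge ?_
      rw [Submodule.span_singleton_le_iff_mem]
      rcases hG g hg a with h1 | ⟨b, h1⟩
      · refine absurd ?_ hy0
        rw [← map_smul, Submodule.mkQ_apply, Submodule.Quotient.mk_eq_zero]
        exact h1
      · have h2 : U.mkQ g = b • a • U.mkQ g := by
          rw [← map_smul, ← map_smul, eq_comm, ← sub_eq_zero, ← map_sub, Submodule.mkQ_apply,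
            Submodule.Quotient.mk_eq_zero]
          exact h1
        rw [h2]
        exact N.smul_mem b hy
    infer_instance

theorem ker_mkQ_comp_subtype (U V : Submodule A M) :
    LinearMap.ker (U.mkQ ∘ₗ V.subtype) = U.submoduleOf V := by
  rw [LinearMap.ker_comp, Submodule.ker_mkQ]; rfl

/-- Both sides are models of V / (U ∩ V). The right-hand one lives inside M / U, where it can be
compared with the socle. -/
theorem isSemisimpleModule_quotient_iff (U V : Submodule A M) :
    IsSemisimpleModule A (V ⧸ U.submoduleOf V) ↔ IsSemisimpleModule A (V.map U.mkQ) := by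
  have e1 := (U.mkQ ∘ₗ V.subtype).quotKerEquivRange
  rw [ker_mkQ_comp_subtype, LinearMap.range_comp, Submodule.range_subtype] at e1
  exact e1.isSemisimpleModule_iff

variable (A M) in
/-- A filtration of length `t` that satisfies the conditions of the rigidity criterion: the layers
are semisimple, each submodule that is not in `V k` meets `V (k + 1)` outside of `V k`, and
`V k` is superfluous in `V (k + 1)` for `k > 0`. -/
structure IsLoewyFiltration (t : ℕ) (V : ℕ → Submodule A M) : Prop where
  mono : Monotone V
  zero : V 0 = ⊥
  top : V t = ⊤
  ne_top : ∀ k < t, V k ≠ ⊤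
  layer : ∀ k < t, IsSemisimpleModule A ((V (k + 1)).map (V k).mkQ)
  meets : ∀ k < t, ∀ N : Submodule A M, ¬ N ≤ V k → ¬ N ⊓ V (k + 1) ≤ V k
  joins : ∀ k < t, 0 < k → ∀ N : Submodule A M, V (k + 1) ≤ N ⊔ V k → V k ≤ N

namespace IsLoewyFiltration
variable {t : ℕ} {V : ℕ → Submodule A M} (hV : IsLoewyFiltration A M t V)
include hV

theorem isSemisimpleFiltration : IsSemisimpleFiltration A M t V where
  mono := hV.mono
  zero := hV.zero
  top := hV.top
  semisimple k hk := (isSemisimpleModule_quotient_iff _ _).mpr (hV.layer k hk)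

/-- A simple submodule of M / V k either lies in the layer or meets it in 0. In the second case its
preimage in M would contradict `meets`. Conversely the layer is semisimple, hence inside the socle.
-/
theorem socleFiltration_eq : ∀ k ≤ t, socleFiltration A M k = V k
  | 0, _ => hV.zero.symm
  | k + 1, hk => by
    rw [socleFiltration, socleFiltration_eq k (by omega)]
    have := hV.layer k hk
    apply le_antisymm
    · have h : socle A (M ⧸ V k) ≤ (V (k + 1)).map (V k).mkQ := by
        refine sSup_le fun S hS => ?_
        have hS' : IsAtom S := isSimpleModule_iff_isAtom.mp hS
        refine hS'.not_disjoint_iff_le.mp fun hd => ?_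
        have h1 : ¬ S.comap (V k).mkQ ≤ V k := by
          intro h
          apply hS'.1
          have := Submodule.map_mono (f := (V k).mkQ) h
          rwa [Submodule.map_comap_eq, Submodule.range_mkQ, top_inf_eq, Submodule.mkQ_map_self,
            le_bot_iff] at this
        refine hV.meets k hk _ h1 fun x hx => ?_
        have h2 : (V k).mkQ x ∈ S ⊓ (V (k + 1)).map (V k).mkQ :=
          ⟨hx.1, Submodule.mem_map_of_mem hx.2⟩
        rwa [hd.eq_bot, Submodule.mem_bot, Submodule.mkQ_apply,
          Submodule.Quotient.mk_eq_zero] at h2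
      refine (Submodule.comap_mono h).trans ?_
      rw [Submodule.comap_map_mkQ]
      exact sup_le (hV.mono (Nat.le_succ k)) le_rfl
    · rw [← Submodule.map_le_iff_le_comap]
      exact le_socle_of_isSemisimpleModule _

/-- The semisimple quotient V (k + 1) / V k has zero radical, which gives one inclusion. For the
other, a maximal submodule that failed to contain V k would together with it generate V (k + 1), and
`joins` would force it to contain V k after all. -/
theorem jacobson_eq (k : ℕ) (hk : k < t) :
    (Module.jacobson A (V (k + 1))).map (V (k + 1)).subtype = V k := by
  have hss := (isSemisimpleModule_quotient_iff _ _).mpr (hV.layer k hk)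
  have hle : V k ≤ V (k + 1) := hV.mono (Nat.le_succ k)
  apply le_antisymm
  · have h := Module.jacobson_le_of_eq_bot
      (IsSemisimpleModule.jacobson_eq_bot A (V (k + 1) ⧸ (V k).submoduleOf (V (k + 1))))
    refine (Submodule.map_mono h).trans ?_
    rw [Submodule.map_le_iff_le_comap]
    exact le_rfl
  · intro x hx
    refine ⟨⟨x, hle hx⟩, ?_, rfl⟩
    rw [SetLike.mem_coe, Module.jacobson, Submodule.mem_sInf]
    intro N hN
    -- The bottom layer is separate because `joins` is available only for k > 0; there V 0 = 0 and
    -- nothing has to be shown.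
    rcases Nat.eq_zero_or_pos k with rfl | hk0
    · rw [hV.zero, Submodule.mem_bot] at hx
      subst hx
      exact N.zero_mem
    by_contra hxN
    have h1 : N ⊔ (V k).submoduleOf (V (k + 1)) = ⊤ := by
      refine hN.2 _ (lt_of_le_of_ne le_sup_left fun h => hxN ?_)
      rw [h]
      exact Submodule.mem_sup_right hx
    have h2 := congrArg (Submodule.map (V (k + 1)).subtype) h1
    rw [Submodule.map_sup, Submodule.map_top, Submodule.range_subtype, Submodule.submoduleOf,
      Submodule.map_comap_subtype] at h2
    obtain ⟨y, hy, hyx⟩ := hV.joins k hk hk0 (N.map (V (k + 1)).subtype)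
      (h2.symm.le.trans (sup_le_sup_left inf_le_right _)) hx
    exact hxN ((Subtype.ext hyx : y = ⟨x, hle hx⟩) ▸ hy)

theorem radicalFiltration_eq (j : ℕ) (hj : j ≤ t) : radicalFiltration A M j = V (t - j) := by
  induction j with
  | zero => rw [radicalFiltration, Nat.sub_zero, hV.top]
  | succ j ih =>
    have := hV.jacobson_eq (t - (j + 1)) (by omega)
    rw [radicalFiltration, ih (by omega)]
    rwa [show t - (j + 1) + 1 = t - j by omega] at this

/-- The socle filtration is the fastest of all: if F k lies in the k-th socle, then the image of F
(k + 1) modulo that socle is a quotient of a semisimple layer of F, hence semisimple. A filtration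
shorter than t would therefore make some V k with k < t equal to M. -/
theorem loewyLength_eq : loewyLength A M = t := by
  apply le_antisymm
  · exact Nat.sInf_le ⟨V, hV.isSemisimpleFiltration⟩
  · refine le_csInf ⟨t, V, hV.isSemisimpleFiltration⟩ ?_
    rintro t' ⟨F, hF⟩
    by_contra hlt
    push Not at hlt
    have h : ∀ k ≤ t', F k ≤ socleFiltration A M k := by
      intro k
      induction k with
      | zero => intro _; rw [hF.zero]; exact bot_le
      | succ k ih =>
        intro hk
        have := (isSemisimpleModule_quotient_iff _ _).mp (hF.semisimple k hk)
        rw [socleFiltration, ← Submodule.map_le_iff_le_comap]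
        have hs : IsSemisimpleModule A ((F (k + 1)).map (socleFiltration A M k).mkQ) := by
          rw [← Submodule.factor_comp_mk (ih (by omega)), Submodule.map_comp]
          refine IsSemisimpleModule.of_surjective
            ((Submodule.factor (ih (by omega))).submoduleMap ((F (k + 1)).map (F k).mkQ)) ?_
          exact LinearMap.submoduleMap_surjective _ _
        exact le_socle_of_isSemisimpleModule _
    apply hV.ne_top t' hlt
    rw [← hV.socleFiltration_eq t' hlt.le, eq_top_iff, ← hF.top]
    exact h t' le_rfl

theorem isRigid : IsRigid A M := by
  refine ⟨⟨t, V, hV.isSemisimpleFiltration⟩, ?_⟩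
  rw [hV.loewyLength_eq]
  intro k hk
  rw [hV.socleFiltration_eq k hk, hV.radicalFiltration_eq _ (Nat.sub_le _ _)]
  congr 1
  omega

end IsLoewyFiltration

end loewyCriterion

/-! ### Integer vectors with prescribed sum, and unit moves -/

section configurations
variable {ι : Type*}

/-- A discrete intermediate value theorem: starting from c, raise one coordinate at a time. It
supplies residue vectors of a given sum within their bounds. -/
theorem exists_sum_eq_of_le [Fintype ι] [DecidableEq ι] {c d : ι → ℕ} (hcd : c ≤ d) (t : ℕ)
    (h1 : ∑ i, c i ≤ t) (h2 : t ≤ ∑ i, d i) : ∃ f, c ≤ f ∧ f ≤ d ∧ ∑ i, f i = t := by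
  induction t, h1 using Nat.le_induction with
  | base => exact ⟨c, le_rfl, hcd, rfl⟩
  | succ t _ ih =>
    obtain ⟨f, hcf, hfd, hf⟩ := ih (by omega)
    obtain ⟨i, -, hi⟩ := Finset.exists_lt_of_sum_lt (s := Finset.univ) (f := f) (g := d) (by omega)
    refine ⟨Function.update f i (f i + 1), fun j => ?_, fun j => ?_, ?_⟩
    · by_cases hj : j = i
      · subst hj; simpa using (hcf j).trans (Nat.le_succ _)
      · simpa [hj] using hcf j
    · by_cases hj : j = i
      · subst hj; simpa using hi
      · simpa [hj] using hfd j
    · have h3 := Finset.add_sum_erase Finset.univ f (Finset.mem_univ i)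
      have h4 := Finset.add_sum_erase Finset.univ (Function.update f i (f i + 1))
        (Finset.mem_univ i)
      have h5 : ∑ x ∈ Finset.univ.erase i, Function.update f i (f i + 1) x =
          ∑ x ∈ Finset.univ.erase i, f x := Finset.sum_congr rfl fun x hx =>
        Function.update_of_ne (Finset.ne_of_mem_erase hx) (f i + 1) f
      rw [Function.update_self] at h4
      omega

/-- Move one unit from the place `i` to the place `j`. -/
def unitMove [DecidableEq ι] (a : ι → ℕ) (i j : ι) : ι → ℕ := fun k =>
  if k = j then a j + 1 else if k = i then a i - 1 else a k

theorem unitMove_add_single [DecidableEq ι] (a : ι → ℕ) {i j : ι} (hij : i ≠ j) (hi : 0 < a i) :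
    unitMove a i j + Pi.single i 1 = a + Pi.single j 1 := by
  funext k
  simp only [Pi.add_apply, unitMove, Pi.single_apply]
  split_ifs <;> simp_all <;> omega

theorem sum_unitMove [Fintype ι] [DecidableEq ι] (a : ι → ℕ) {i j : ι} (hij : i ≠ j) (hi : 0 < a i) :
    ∑ k, unitMove a i j k = ∑ k, a k := by
  have h := congrArg (fun f => ∑ k, f k) (unitMove_add_single a hij hi)
  simpa [Finset.sum_add_distrib] using h

end configurations

/-! ### Residues and quotients modulo ℓ of the exponents -/

section resQuo
variable {m n : ℕ} (l : ℕ)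

/-- The residues modulo `l` of the exponents. -/
def Mon.res (β : Mon m n) : Fin (m + n) → ℕ := fun k => β.1 k % l

/-- The quotients by `l` of the exponents. -/
def Mon.quo (β : Mon m n) : Fin (m + n) → ℕ := fun k => β.1 k / l

variable (m n) in
/-- The largest possible residues. -/
def cap : Fin (m + n) → ℕ := fun k => if k.val < m then l - 1 else 1

variable {l}

theorem cap_pos (hl : 2 ≤ l) (k : Fin (m + n)) : 0 < cap m n l k := by
  unfold cap; split_ifs <;> omega

theorem Mon.res_le_cap (hl : 2 ≤ l) (β : Mon m n) : β.res l ≤ cap m n l := fun k => by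
  change β.1 k % l ≤ if k.val < m then l - 1 else 1
  split_ifs with h
  · have := Nat.mod_lt (β.1 k) (show 0 < l by omega); omega
  · exact (Nat.mod_le _ _).trans (β.2 k (by omega))

theorem Mon.quo_eq_zero (hl : 2 ≤ l) (β : Mon m n) (k : Fin (m + n)) (hk : m ≤ k.val) :
    β.quo l k = 0 := Nat.div_eq_of_lt (by have := β.2 k hk; omega)

theorem Mon.res_add_quo (β : Mon m n) (k : Fin (m + n)) :
    β.res l k + l * β.quo l k = β.1 k := Nat.mod_add_div _ _

theorem Mon.ext_res_quo {β γ : Mon m n} (h1 : β.res l = γ.res l) (h2 : β.quo l = γ.quo l) :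
    β = γ := by
  apply Subtype.ext
  funext k
  rw [← β.res_add_quo (l := l), ← γ.res_add_quo (l := l), h1, h2]

theorem Mon.energy_eq_sum_quo (hl : 2 ≤ l) (β : Mon m n) : β.energy l = ∑ k, β.quo l k := by
  rw [Fin.sum_univ_add, Finset.sum_eq_zero (s := Finset.univ)
    (f := fun i : Fin n => β.quo l (Fin.natAdd m i))
    (fun i _ => β.quo_eq_zero hl _ (by simp)), add_zero]
  rfl

/-- In a fixed degree this trades one unit of energy for exactly ℓ units of residue; all room
estimates below come from it. -/
theorem Mon.deg_eq (hl : 2 ≤ l) (β : Mon m n) :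
    β.deg = ∑ k, β.res l k + l * β.energy l := by
  rw [β.energy_eq_sum_quo hl, Finset.mul_sum, ← Finset.sum_add_distrib]
  exact Finset.sum_congr rfl fun k _ => (β.res_add_quo k).symm

theorem Mon.exists_res_quo (hl : 2 ≤ l) {a κ : Fin (m + n) → ℕ} (ha : a ≤ cap m n l)
    (hκ : ∀ k : Fin (m + n), m ≤ k.val → κ k = 0) :
    ∃ β : Mon m n, β.res l = a ∧ β.quo l = κ := by
  have h : ∀ k, a k < l := fun k => by
    have : a k ≤ if k.val < m then l - 1 else 1 := ha k
    split_ifs at this <;> omega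
  refine ⟨⟨fun k => a k + l * κ k, fun k hk => ?_⟩, ?_, ?_⟩
  · have := ha k
    rw [cap, if_neg (by omega)] at this
    simp only [hκ k hk]
    simpa using this
  · funext k
    simp [Mon.res, Nat.mod_eq_of_lt (h k)]
  · funext k
    simp [Mon.quo, Nat.add_mul_div_left _ _ (show 0 < l by omega), Nat.div_eq_of_lt (h k)]

theorem mod_div_of_eq {x Q R : ℕ} (hR : R < l) (h : x = R + l * Q) : x % l = R ∧ x / l = Q :=
  ((Nat.div_mod_unique (by omega)).mpr ⟨h.symm, hR⟩).symm

end resQuo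

/-! ### Vanishing of quantum integers and the order of q² -/

section qNumbers
variable {K : Type*} [Field K] [CharZero K] (q : K) [Fact (3 ≤ qChar q)]

theorem qInt_eq_zero_iff (k : ℕ) : qInt q k = 0 ↔ q ^ (2 * k) = 1 := by
  have h0 := q_ne_zero q
  rw [qInt_eq, mul_eq_zero, or_iff_left (inv_ne_zero (q_sub_ne_zero q)), sub_eq_zero, zpow_neg,
    zpow_natCast, ← mul_eq_one_iff_eq_inv₀ (pow_ne_zero _ h0), ← pow_add, two_mul]

/-- [k] vanishes exactly when q^(2k) = 1, so the minimality in `qChar` is that of the order. It is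
q², not q, whose order is determined: q may have order ℓ or 2ℓ. -/
theorem orderOf_sq : orderOf (q ^ 2) = qChar q := by
  have h3 : 3 ≤ qChar q := Fact.out
  refine (orderOf_eq_iff (by omega)).mpr ⟨?_, fun k hk h0 => ?_⟩
  · rw [← pow_mul]; exact q_pow_two_qChar q
  · rw [← pow_mul]
    exact fun h => qInt_ne_of_lt q h0 hk ((qInt_eq_zero_iff q k).mpr h)

theorem qInt_eq_zero_iff_dvd (k : ℕ) : qInt q k = 0 ↔ qChar q ∣ k := by
  rw [qInt_eq_zero_iff, pow_mul, ← orderOf_dvd_iff_pow_eq_one, orderOf_sq]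

theorem orderOf_qSite_sq (m i : ℕ) : orderOf (qSite q m i ^ 2) = qChar q := by
  unfold qSite
  split_ifs
  · exact orderOf_sq q
  · rw [inv_pow, ← orderOf_sq q]
    simp only [orderOf_eq_orderOf_iff, inv_pow, inv_eq_one, implies_true]

end qNumbers

/-! ### Moving units between places by elements of the algebra -/

section moves
variable {K : Type*} [Field K] [CharZero K] (q : K) [Fact (3 ≤ qChar q)] {m n : ℕ}

/-- The places `i` and `k` are neighbours. -/
def IsNbr (i k : Fin (m + n)) : Prop := i.val + 1 = k.val ∨ k.val + 1 = i.val

theorem IsNbr.ne {i k : Fin (m + n)} (h : IsNbr i k) : i ≠ k := by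
  rintro rfl
  rcases h with h | h <;> omega

theorem genAct_mem_range (g : Gen m n) : genAct q m n g ∈ (Uq.act q m n).range :=
  ⟨Uq.mk q m n (FreeAlgebra.ι K g), by
    rw [AlgHom.toRingHom_eq_coe, RingHom.coe_coe, Uq.act_mk, FreeAlgebra.lift_ι_apply]⟩

/-- A move to the right is some f_j and a move to the left some e_j; from here on the two are
treated alike. -/
theorem opR_mul_opL_mem_range {i k : Fin (m + n)} (h : IsNbr i k) :
    opR q k * opL q i ∈ (Uq.act q m n).range := by
  rcases h with h | h
  · have := genAct_mem_range q (Gen.f (m := m) (n := n) ⟨i.val, by omega⟩)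
    rwa [genAct, show hi (m := m) (n := n) ⟨i.val, by omega⟩ = k from Fin.ext h] at this
  · have := genAct_mem_range q (Gen.e (m := m) (n := n) ⟨k.val, by omega⟩)
    rwa [genAct, show hi (m := m) (n := n) ⟨k.val, by omega⟩ = i from Fin.ext h] at this

/-- At an even place [β_k + 1] vanishes exactly when ℓ divides β_k + 1, that is, at residue ℓ-1. At
an odd place the coefficient vanishes when the place is occupied. In both cases this is the
statement that the residue is full. -/
theorem raiseCoeff_ne_zero_iff (k : Fin (m + n)) (β : Mon m n) :
    raiseCoeff q k β ≠ 0 ↔ β.res (qChar q) k < cap m n (qChar q) k := by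
  have h3 : 3 ≤ qChar q := Fact.out
  unfold raiseCoeff cap Mon.res
  split_ifs with h h1
  · rw [Ne, qInt_eq_zero_iff_dvd, Nat.dvd_iff_mod_eq_zero]
    have h2 := Nat.mod_lt (β.1 k) (show 0 < qChar q by omega)
    rcases Nat.lt_or_ge (β.1 k % qChar q) (qChar q - 1) with h4 | h4
    · have h5 : (β.1 k + 1) % qChar q = β.1 k % qChar q + 1 :=
        (mod_div_of_eq (Q := β.1 k / qChar q) (by omega)
          (by have := Nat.mod_add_div (β.1 k) (qChar q); omega)).1
      omega
    · have h5 : (β.1 k + 1) % qChar q = 0 :=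
        (mod_div_of_eq (Q := β.1 k / qChar q + 1) (by omega)
          (by have := Nat.mod_add_div (β.1 k) (qChar q); rw [mul_add]; omega)).1
      omega
  · simp [h1]
  · have := β.2 k (by omega)
    rw [Nat.mod_eq_of_lt (by omega)]
    simp only [ne_eq, not_true_eq_false, false_iff, not_lt]
    omega

/-- The monomial obtained by moving one unit from `i` to `k`. -/
def Mon.move (β : Mon m n) (i k : Fin (m + n)) : Mon m n := (β.lower i).raise k

theorem word_x {i k : Fin (m + n)} (h : k ≠ i) (β : Mon m n) :
    (opR q k * opL q i) (Omega.x q β) =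
      (if β.1 i = 0 then 0 else raiseCoeff q k β) • Omega.x q (β.move i k) := by
  rw [Module.End.mul_apply, opL_x, map_smul, opR_x, smul_smul, Mon.move]
  congr 1
  simp only [raiseCoeff, Mon.lower_ne β h]
  split_ifs <;> simp

/-- `Mon.raise` sets an odd entry to 1 whatever it was; a nonzero coefficient means that the entry
was 0, so that the move really adds a unit. -/
theorem Mon.move_apply {i k : Fin (m + n)} (h : k ≠ i) {β : Mon m n}
    (hk : raiseCoeff q k β ≠ 0) (j : Fin (m + n)) :
    (β.move i k).1 j = if j = k then β.1 k + 1 else if j = i then β.1 i - 1 else β.1 j := by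
  rw [Mon.move]
  split_ifs with h1 h2
  · subst h1
    rw [Mon.raise_self, Mon.lower_ne _ h]
    split_ifs with h3
    · rfl
    · rw [raiseCoeff, if_neg h3] at hk
      by_contra h4
      exact hk (if_neg (by omega))
  · subst h2
    rw [Mon.raise_ne _ h1, Mon.lower_self]
  · rw [Mon.raise_ne _ h1, Mon.lower_ne _ h2]

/-- At the place of arrival, a move with nonzero coefficient raises the residue. -/
theorem succ_mod_div {k : Fin (m + n)} {β : Mon m n} (hk : raiseCoeff q k β ≠ 0) :
    (β.1 k + 1) % qChar q = β.res (qChar q) k + 1 ∧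
      (β.1 k + 1) / qChar q = β.quo (qChar q) k := by
  have h3 : 3 ≤ qChar q := Fact.out
  rw [raiseCoeff_ne_zero_iff] at hk
  have h4 : cap m n (qChar q) k < qChar q := by unfold cap; split_ifs <;> omega
  refine mod_div_of_eq (by omega) ?_
  have := β.res_add_quo (l := qChar q) k
  omega

/-- Some element of the algebra takes each monomial with the residues `a` to a nonzero multiple of
the monomial with the residues `a'` and the same quotients. -/
def Reach (a a' : Fin (m + n) → ℕ) : Prop :=
  ∃ b ∈ (Uq.act q m n).range, ∀ β : Mon m n, β.res (qChar q) = a →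
    ∃ (β' : Mon m n) (c : K), c ≠ 0 ∧ β'.res (qChar q) = a' ∧
      β'.quo (qChar q) = β.quo (qChar q) ∧ b (Omega.x q β) = c • Omega.x q β'

/-- Some element of the algebra takes each monomial with the residues `a` to a nonzero multiple of
the monomial with the residues `a'` and the quotients lowered by one at `i`, or to `0` if the
quotient at `i` is zero. -/
def Drop (i : Fin (m + n)) (a a' : Fin (m + n) → ℕ) : Prop :=
  ∃ b ∈ (Uq.act q m n).range, ∀ β : Mon m n, β.res (qChar q) = a →
    (β.quo (qChar q) i = 0 → b (Omega.x q β) = 0) ∧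
    (β.quo (qChar q) i ≠ 0 → ∃ (β' : Mon m n) (c : K), c ≠ 0 ∧ β'.res (qChar q) = a' ∧
      β'.quo (qChar q) + Pi.single i 1 = β.quo (qChar q) ∧
      b (Omega.x q β) = c • Omega.x q β')

variable {q}

theorem Reach.refl (a : Fin (m + n) → ℕ) : Reach q a a :=
  ⟨1, one_mem _, fun β h => ⟨β, 1, one_ne_zero, h, rfl, by simp⟩⟩

theorem Reach.trans {a a' a'' : Fin (m + n) → ℕ} (h : Reach q a a') (h' : Reach q a' a'') :
    Reach q a a'' := by
  obtain ⟨b, hb, h⟩ := h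
  obtain ⟨b', hb', h'⟩ := h'
  refine ⟨b' * b, mul_mem hb' hb, fun β hβ => ?_⟩
  obtain ⟨γ, c, hc, h1, h2, h3⟩ := h β hβ
  obtain ⟨γ', c', hc', h1', h2', h3'⟩ := h' γ h1
  exact ⟨γ', c * c', mul_ne_zero hc hc', h1', h2'.trans h2, by
    rw [Module.End.mul_apply, h3, map_smul, h3', smul_smul]⟩

theorem Reach.trans_drop {i : Fin (m + n)} {a a' a'' : Fin (m + n) → ℕ} (h : Reach q a a')
    (h' : Drop q i a' a'') : Drop q i a a'' := by
  obtain ⟨b, hb, h⟩ := h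
  obtain ⟨b', hb', h'⟩ := h'
  refine ⟨b' * b, mul_mem hb' hb, fun β hβ => ?_⟩
  obtain ⟨γ, c, hc, h1, h2, h3⟩ := h β hβ
  obtain ⟨h4, h5⟩ := h' γ h1
  rw [Module.End.mul_apply, h3, map_smul, ← h2]
  refine ⟨fun h0 => by rw [h4 h0, smul_zero], fun h0 => ?_⟩
  obtain ⟨γ', c', hc', h1', h2', h3'⟩ := h5 h0
  exact ⟨γ', c * c', mul_ne_zero hc hc', h1', h2', by rw [h3', smul_smul]⟩

theorem Drop.trans_reach {i : Fin (m + n)} {a a' a'' : Fin (m + n) → ℕ} (h : Drop q i a a')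
    (h' : Reach q a' a'') : Drop q i a a'' := by
  obtain ⟨b, hb, h⟩ := h
  obtain ⟨b', hb', h'⟩ := h'
  refine ⟨b' * b, mul_mem hb' hb, fun β hβ => ?_⟩
  obtain ⟨h4, h5⟩ := h β hβ
  rw [Module.End.mul_apply]
  refine ⟨fun h0 => by rw [h4 h0, map_zero], fun h0 => ?_⟩
  obtain ⟨γ, c, hc, h1, h2, h3⟩ := h5 h0
  obtain ⟨γ', c', hc', h1', h2', h3'⟩ := h' γ h1
  exact ⟨γ', c * c', mul_ne_zero hc hc', h1', by rw [h2', h2], by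
    rw [h3, map_smul, h3', smul_smul]⟩

/-- With a positive residue at the departure there is no borrow, and a nonzero coefficient means no
carry at the arrival. -/
theorem reach_of_isNbr {a : Fin (m + n) → ℕ} {i k : Fin (m + n)} (hik : IsNbr i k)
    (hi : 0 < a i) (hk : a k < cap m n (qChar q) k) : Reach q a (unitMove a i k) := by
  refine ⟨_, opR_mul_opL_mem_range q hik, ?_⟩
  rintro β rfl
  have hc := (raiseCoeff_ne_zero_iff q k β).mpr hk
  have hb := β.res_add_quo (l := qChar q) i
  have h1 := succ_mod_div q hc
  have h2 : (β.1 i - 1) % qChar q = β.res (qChar q) i - 1 ∧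
      (β.1 i - 1) / qChar q = β.quo (qChar q) i := by
    have : β.res (qChar q) i < qChar q := Nat.mod_lt _ (by have : 3 ≤ qChar q := Fact.out; omega)
    exact mod_div_of_eq (by omega) (by omega)
  refine ⟨β.move i k, _, hc, ?_, ?_, ?_⟩
  · funext j
    rw [Mon.res, Mon.move_apply q hik.ne.symm hc, unitMove]
    split_ifs
    exacts [h1.1, h2.1, rfl]
  · funext j
    rw [Mon.quo, Mon.move_apply q hik.ne.symm hc]
    split_ifs with h3 h4
    exacts [h1.2.trans (by rw [h3]), h2.2.trans (by rw [h4]), rfl]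
  · rw [word_x q hik.ne.symm, if_neg (by omega)]

/-- The borrow: at residue 0 the exponent at i is ℓκ_i. If κ_i = 0 there is nothing to take;
otherwise ℓκ_i - 1 = (ℓ-1) + ℓ(κ_i - 1). -/
theorem drop_of_isNbr {a : Fin (m + n) → ℕ} {i k : Fin (m + n)} (hik : IsNbr i k)
    (hi : a i = 0) (hk : a k < cap m n (qChar q) k) :
    Drop q i a (a + (Pi.single k 1 + Pi.single i (qChar q - 1))) := by
  have h3 : 3 ≤ qChar q := Fact.out
  refine ⟨_, opR_mul_opL_mem_range q hik, ?_⟩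
  rintro β rfl
  have hc := (raiseCoeff_ne_zero_iff q k β).mpr hk
  have hb := β.res_add_quo (l := qChar q) i
  have h1 := succ_mod_div q hc
  rw [word_x q hik.ne.symm]
  rw [hi, zero_add] at hb
  refine ⟨fun h0 => ?_, fun h0 => ?_⟩
  · rw [h0, mul_zero] at hb
    rw [if_pos hb.symm, zero_smul]
  obtain ⟨Q, hQ⟩ := Nat.exists_eq_succ_of_ne_zero h0
  rw [hQ, Nat.succ_eq_add_one, mul_add, mul_one] at hb
  have h2 : (β.1 i - 1) % qChar q = qChar q - 1 ∧ (β.1 i - 1) / qChar q = Q :=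
    mod_div_of_eq (by omega) (by omega)
  have hki := hik.ne.symm
  refine ⟨β.move i k, _, hc, ?_, ?_, ?_⟩
  · funext j
    rw [Mon.res, Mon.move_apply q hki hc]
    simp only [Pi.add_apply, Pi.single_apply]
    split_ifs with h4 h5 h5
    · exact absurd (h4.symm.trans h5) hki
    · rw [h1.1, h4, add_zero]
    · rw [h2.1, h5, hi, zero_add, zero_add]
    · rfl
  · funext j
    simp only [Pi.add_apply, Pi.single_apply]
    rw [Mon.quo, Mon.move_apply q hki hc]
    split_ifs with h4 h5 h5
    · exact absurd (h4.symm.trans h5) hki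
    · rw [h1.2, h4, add_zero]
    · rw [h2.2, h5, hQ]
    · rfl
  · rw [if_neg (by omega)]

/-- Induction on the distance of the two places, written with truncated subtractions as (i - j) + (j
- i). The unit passes through the neighbour k of i on the side of j. -/
theorem reach_unitMove (d : ℕ) : ∀ (a : Fin (m + n) → ℕ) (i j : Fin (m + n)), i ≠ j →
    (i.val - j.val) + (j.val - i.val) ≤ d → 0 < a i → a j < cap m n (qChar q) j →
    Reach q a (unitMove a i j) := by
  have h3 : 3 ≤ qChar q := Fact.out
  induction d with
  | zero =>
    intro a i j hij hd
    exact absurd (Fin.ext (by omega)) hij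
  | succ d ih =>
    intro a i j hij hd hi hj
    have hij' : i.val ≠ j.val := fun h => hij (Fin.ext h)
    by_cases hn : IsNbr i j
    · exact reach_of_isNbr hn hi hj
    obtain ⟨k, hik, hkj, hdk⟩ : ∃ k : Fin (m + n), IsNbr i k ∧ k ≠ j ∧
        (k.val - j.val) + (j.val - k.val) ≤ d := by
      have hj := j.2
      have hi := i.2
      unfold IsNbr at hn ⊢
      rcases Nat.lt_or_ge i.val j.val with h | h
      · refine ⟨⟨i.val + 1, by omega⟩, Or.inl rfl, fun e => ?_, ?_⟩
        · have := congrArg Fin.val e; simp only at this; omega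
        · simp only; omega
      · refine ⟨⟨i.val - 1, by omega⟩, Or.inr ?_, fun e => ?_, ?_⟩
        · simp only; omega
        · have := congrArg Fin.val e; simp only at this; omega
        · simp only; omega
    have hik' := hik.ne
    -- If k has room, the unit goes from i to k and then on to j. If k is full, one of its own units
    -- is first sent to j, and the gap is then filled from i.
    by_cases hk : a k < cap m n (qChar q) k
    · have h1 := ih (unitMove a i k) k j hkj hdk (by simp [unitMove])
        (by simpa [unitMove, hkj.symm, hij.symm] using hj)
      have h2 : unitMove (unitMove a i k) k j = unitMove a i j := by
        funext x
        simp only [unitMove]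
        split_ifs <;> simp_all
      rw [h2] at h1
      exact (reach_of_isNbr hik hi hk).trans h1
    · have hk0 := cap_pos (m := m) (n := n) (show 2 ≤ qChar q by omega) k
      rw [not_lt] at hk
      by_cases hk' : a k = cap m n (qChar q) k
      · have h1 := reach_of_isNbr (q := q) (a := unitMove a k j) hik
          (by simpa [unitMove, hij, hik'] using hi) (by simp [unitMove, hkj]; omega)
        have h2 : unitMove (unitMove a k j) i k = unitMove a i j := by
          funext x
          simp only [unitMove]
          split_ifs <;> simp_all
          omega
        rw [h2] at h1
        exact (ih a k j hkj hdk (by omega) hj).trans h1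
      -- No monomial has a residue above its bound, so any operator will do.
      · refine ⟨1, one_mem _, fun β hβ => ?_⟩
        have : β.res (qChar q) k ≤ cap m n (qChar q) k := β.res_le_cap (by omega) k
        rw [hβ] at this
        omega

/-- Unless a = a', equality of the sums gives a place with too many units and one with too few.
Moving a unit from the first to the second lowers the total excess Σ(a_k - a'_k), where the
subtraction is truncated. -/
theorem reach_of_sum_eq {a a' : Fin (m + n) → ℕ} (ha' : a' ≤ cap m n (qChar q))
    (h : ∑ k, a k = ∑ k, a' k) : Reach q a a' := by
  induction hd : ∑ k, (a k - a' k) using Nat.strong_induction_on generalizing a with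
  | _ d ih =>
    by_cases hle : a ≤ a'
    · rw [show a = a' from funext fun k =>
        (Finset.sum_eq_sum_iff_of_le fun k _ => hle k).mp h k (Finset.mem_univ k)]
      exact Reach.refl a'
    have hle' : ¬ a' ≤ a := fun hle' => hle (le_of_eq (funext fun k =>
      (Finset.sum_eq_sum_iff_of_le fun k _ => hle' k).mp h.symm k (Finset.mem_univ k)).symm)
    simp only [Pi.le_def, not_forall, not_le] at hle hle'
    obtain ⟨i, hi⟩ := hle
    obtain ⟨j, hj⟩ := hle'
    have hij : i ≠ j := by rintro rfl; omega
    refine (reach_unitMove _ a i j hij le_rfl (by omega) (hj.trans_le (ha' j))).trans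
      (ih _ ?_ ((sum_unitMove a hij (by omega)).trans h) rfl)
    rw [← hd]
    refine Finset.sum_lt_sum (fun k _ => ?_) ⟨i, Finset.mem_univ i, ?_⟩
    · unfold unitMove
      split_ifs with h1 h2
      · subst h1; omega
      · subst h2; omega
      · exact le_rfl
    · rw [unitMove, if_neg hij, if_pos rfl]; omega

/-- Rearrange the residues so that i is empty and a neighbour k has room, borrow at i, and rearrange
again to reach a'. -/
theorem drop_of_sum_eq (hm : 2 ≤ m) {a a' : Fin (m + n) → ℕ} {i : Fin (m + n)} (him : i.val < m)
    (ha' : a' ≤ cap m n (qChar q)) (h : ∑ k, a' k = ∑ k, a k + qChar q) : Drop q i a a' := by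
  have h3 : 3 ≤ qChar q := Fact.out
  obtain ⟨k, hik⟩ : ∃ k : Fin (m + n), IsNbr i k := by
    unfold IsNbr
    by_cases h0 : i.val = 0
    · exact ⟨⟨1, by omega⟩, Or.inl (by simp only; omega)⟩
    · exact ⟨⟨i.val - 1, by omega⟩, Or.inr (by simp only; omega)⟩
  -- c is the change of residues under the borrow. Any f between c and the bounds has f_i = ℓ-1, so
  -- f - c is empty at i and not full at k; this is the configuration just before the borrow.
  set c : Fin (m + n) → ℕ := Pi.single k 1 + Pi.single i (qChar q - 1) with hc
  have hcs : ∑ j, c j = qChar q := by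
    simp only [hc, Pi.add_apply, Finset.sum_add_distrib, Finset.sum_pi_single', Finset.mem_univ,
      if_true]
    omega
  have hcap := cap_pos (m := m) (n := n) (show 2 ≤ qChar q by omega) k
  have hki := hik.ne.symm
  have hcc : c ≤ cap m n (qChar q) := fun j => by
    simp only [hc, Pi.add_apply, Pi.single_apply]
    split_ifs with h4 h5 h5
    · exact absurd (h4.symm.trans h5) hki
    · rw [h4]; exact hcap
    · rw [h5, cap, if_pos him]; omega
    · exact Nat.zero_le _
  obtain ⟨f, hcf, hfc, hf⟩ := exists_sum_eq_of_le hcc (∑ j, a' j) (by omega)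
    (Finset.sum_le_sum fun j _ => ha' j)
  have hfa : f - c + c = f := funext fun j => Nat.sub_add_cancel (hcf j)
  have hs : ∑ j, (f - c) j + qChar q = ∑ j, f j := by
    rw [← hcs, ← Finset.sum_add_distrib]
    exact Finset.sum_congr rfl fun j _ => congrFun hfa j
  have hci : c i = qChar q - 1 := by simp [hc, hik.ne]
  have hck : c k = 1 := by simp [hc, hki]
  have h1 := drop_of_isNbr (q := q) (a := f - c) hik
    (by
      have h4 : f i ≤ cap m n (qChar q) i := hfc i
      rw [cap, if_pos him] at h4
      rw [Pi.sub_apply]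
      omega)
    (by
      have h4 : f k ≤ cap m n (qChar q) k := hfc k
      have h5 : c k ≤ f k := hcf k
      rw [Pi.sub_apply]
      omega)
  rw [← hc, hfa] at h1
  refine (reach_of_sum_eq (fun j => ?_) (by omega)).trans_drop (h1.trans_reach
    (reach_of_sum_eq ha' hf))
  exact (Nat.sub_le _ _).trans (hfc j)

end moves

/-! ### Projections by residues, invariant spans and coefficients -/

section range
variable {K : Type*} [Field K] [CharZero K] (q : K) [Fact (3 ≤ qChar q)] {m n : ℕ}

/-- The functions `c` of a monomial such that `x^β ↦ c(β) x^β` is the action of an element of the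
algebra. -/
noncomputable def diagSubalgebra (m n : ℕ) : Subalgebra K (Mon m n → K) where
  carrier := {c | opD q c ∈ (Uq.act q m n).range}
  mul_mem' {c d} hc hd := by
    have := (Uq.act q m n).range.mul_mem hc hd
    rwa [opD_mul_opD] at this
  add_mem' {c d} hc hd := by
    have h : opD q (c + d) = opD q c + opD q d := end_ext q fun β => by
      rw [LinearMap.add_apply, opD_x, opD_x, opD_x, Pi.add_apply, add_smul]
    rw [Set.mem_ofPred_eq, h]
    exact add_mem hc hd
  algebraMap_mem' a := by
    have h : opD q (algebraMap K (Mon m n → K) a) = algebraMap K _ a := end_ext q fun β => by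
      rw [opD_x, Module.algebraMap_end_apply]; rfl
    rw [Set.mem_ofPred_eq, h]
    exact Subalgebra.algebraMap_mem _ _

theorem qSite_pow_mem_diagSubalgebra (i : Fin (m + n)) :
    (fun β : Mon m n => qSite q m i ^ β.1 i) ∈ diagSubalgebra q m n :=
  genAct_mem_range q (Gen.k i)

theorem qSite_sq_pow_eq_iff (i a b : ℕ) (ha : a < qChar q) :
    (qSite q m i ^ 2) ^ b = (qSite q m i ^ 2) ^ a ↔ b % qChar q = a := by
  have h0 : qSite q m i ^ 2 ≠ 0 := pow_ne_zero _ (qSite_ne_zero q i)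
  rw [← pow_mod_orderOf, orderOf_qSite_sq]
  refine ⟨fun h => ?_, fun h => by rw [h]⟩
  refine pow_injOn_Iio_orderOf (x := qSite q m i ^ 2) ?_ ?_ h
  · rw [orderOf_qSite_sq, Set.mem_Iio]
    exact Nat.mod_lt _ (by omega)
  · rw [orderOf_qSite_sq, Set.mem_Iio]
    exact ha

/-- The projection onto the span of the monomials with given residues belongs to the algebra. -/
theorem exists_projection (a : Fin (m + n) → ℕ) (ha : ∀ i, a i < qChar q) :
    ∃ b ∈ (Uq.act q m n).range, ∀ β : Mon m n,
      b (Omega.x q β) = if β.res (qChar q) = a then Omega.x q β else 0 := by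
  -- Lagrange factors in the eigenvalue of K_i², which depends exactly on β_i modulo ℓ: each is 1 at
  -- residue a_i and 0 at residue d.
  set g : Fin (m + n) → ℕ → Mon m n → K := fun i d =>
    ((qSite q m i ^ 2) ^ a i - (qSite q m i ^ 2) ^ d)⁻¹ •
      ((fun β : Mon m n => qSite q m i ^ β.1 i) ^ 2 - algebraMap K _ ((qSite q m i ^ 2) ^ d))
    with hg
  have hgm : ∀ i d, g i d ∈ diagSubalgebra q m n := fun i d =>
    Subalgebra.smul_mem _ (sub_mem (pow_mem (qSite_pow_mem_diagSubalgebra q i) 2)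
      (Subalgebra.algebraMap_mem _ _)) _
  have hga : ∀ i d β, g i d β = ((qSite q m i ^ 2) ^ a i - (qSite q m i ^ 2) ^ d)⁻¹ *
      ((qSite q m i ^ 2) ^ β.1 i - (qSite q m i ^ 2) ^ d) := fun i d β => by
    simp only [hg, Pi.smul_apply, Pi.sub_apply, Pi.pow_apply, smul_eq_mul, Pi.algebraMap_apply,
      Algebra.algebraMap_self_apply]
    rw [pow_right_comm (qSite q m i) (β.1 i) 2]
  refine ⟨opD q (∏ i, ∏ d ∈ (Finset.range (qChar q)).erase (a i), g i d),
    (diagSubalgebra q m n).prod_mem fun i _ => (diagSubalgebra q m n).prod_mem fun d _ => hgm i d, fun β => ?_⟩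
  rw [opD_x, Finset.prod_apply]
  split_ifs with h
  · rw [Finset.prod_eq_one, one_smul]
    intro i _
    rw [Finset.prod_apply]
    refine Finset.prod_eq_one fun d hd => ?_
    have h1 : (qSite q m i ^ 2) ^ β.1 i = (qSite q m i ^ 2) ^ a i :=
      (qSite_sq_pow_eq_iff q _ _ _ (ha i)).mpr (congrFun h i)
    rw [hga, h1]
    refine inv_mul_cancel₀ (sub_ne_zero.mpr fun h2 => ?_)
    rw [Finset.mem_erase, Finset.mem_range] at hd
    rw [qSite_sq_pow_eq_iff q _ _ _ hd.2, Nat.mod_eq_of_lt (ha i)] at h2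
    exact hd.1 h2.symm
  · obtain ⟨i, hi⟩ := Function.ne_iff.mp h
    have h1 : β.1 i % qChar q < qChar q := Nat.mod_lt _ ((Nat.zero_le _).trans_lt (ha i))
    rw [Finset.prod_eq_zero (Finset.mem_univ i), zero_smul]
    rw [Finset.prod_apply]
    refine Finset.prod_eq_zero (i := β.1 i % qChar q)
      (Finset.mem_erase.mpr ⟨hi, Finset.mem_range.mpr h1⟩) ?_
    rw [hga, (qSite_sq_pow_eq_iff q i _ (β.1 i) h1).mpr rfl, sub_self, mul_zero]

/-- A set of monomials that is closed under the moves with nonzero coefficients spans a subspace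
that is invariant under the algebra. -/
theorem map_mem_span_of_closed {P : Set (Mon m n)}
    (hP : ∀ β ∈ P, ∀ i k, IsNbr i k → β.1 i ≠ 0 → raiseCoeff q k β ≠ 0 → β.move i k ∈ P)
    {b : Module.End K (Omega q m n)} (hb : b ∈ (Uq.act q m n).range) {y : Omega q m n}
    (hy : y ∈ Submodule.span K (Omega.x q '' P)) : b y ∈ Submodule.span K (Omega.x q '' P) := by
  have hword : ∀ {i k : Fin (m + n)}, IsNbr i k → ∀ β ∈ P,
      (opR q k * opL q i) (Omega.x q β) ∈ Submodule.span K (Omega.x q '' P) := by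
    intro i k hik β hβ
    rw [word_x q hik.ne.symm]
    split_ifs with h0
    · rw [zero_smul]; exact zero_mem _
    · by_cases hc : raiseCoeff q k β = 0
      · rw [hc, zero_smul]; exact zero_mem _
      · exact Submodule.smul_mem _ _ (Submodule.subset_span ⟨_, hP β hβ i k hik h0 hc, rfl⟩)
  have hgen : ∀ g : Gen m n, Submodule.span K (Omega.x q '' P) ≤
      (Submodule.span K (Omega.x q '' P)).comap (genAct q m n g) := by
    intro g
    rw [Submodule.span_le]
    rintro _ ⟨β, hβ, rfl⟩
    cases g with
    | e j => exact hword (i := hi j) (k := lo j) (Or.inr rfl) β hβ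
    | f j => exact hword (i := lo j) (k := hi j) (Or.inl rfl) β hβ
    | k i =>
      rw [SetLike.mem_coe, Submodule.mem_comap, genAct, opD_x]
      exact Submodule.smul_mem _ _ (Submodule.subset_span ⟨_, hβ, rfl⟩)
    | kinv i =>
      rw [SetLike.mem_coe, Submodule.mem_comap, genAct, opD_x]
      exact Submodule.smul_mem _ _ (Submodule.subset_span ⟨_, hβ, rfl⟩)
  obtain ⟨u, rfl⟩ := hb
  obtain ⟨w, rfl⟩ := Uq.mk_surjective q m n u
  rw [AlgHom.toRingHom_eq_coe, RingHom.coe_coe, Uq.act_mk]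
  induction w using FreeAlgebra.induction generalizing y with
  | grade0 c =>
    rw [AlgHom.commutes, Module.algebraMap_end_apply]
    exact Submodule.smul_mem _ _ hy
  | grade1 g => rw [FreeAlgebra.lift_ι_apply]; exact hgen g hy
  | mul a b ha hb => rw [map_mul, Module.End.mul_apply]; exact ha (hb hy)
  | add a b ha hb => rw [map_add, LinearMap.add_apply]; exact Submodule.add_mem _ (ha hy) (hb hy)

variable {q} in
/-- A move with a nonzero coefficient keeps the quotients or lowers the energy grade. -/
theorem quo_move_or_energy_lt {β : Mon m n} {i k : Fin (m + n)} (h : k ≠ i)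
    (hc : raiseCoeff q k β ≠ 0) : (β.move i k).quo (qChar q) = β.quo (qChar q) ∨
      (β.move i k).energy (qChar q) < β.energy (qChar q) := by
  have h3 : 3 ≤ qChar q := Fact.out
  have hle : ∀ j, (β.move i k).quo (qChar q) j ≤ β.quo (qChar q) j := fun j => by
    rw [Mon.quo, Mon.move_apply q h hc]
    split_ifs with h1 h2
    · rw [(succ_mod_div q hc).2, h1]
    · rw [h2]; exact Nat.div_le_div_right (Nat.sub_le _ _)
    · exact le_rfl
  rw [Mon.energy_eq_sum_quo (by omega), Mon.energy_eq_sum_quo (by omega)]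
  by_cases he : (β.move i k).quo (qChar q) = β.quo (qChar q)
  · exact Or.inl he
  · obtain ⟨j, hj⟩ := Function.ne_iff.mp he
    exact Or.inr (Finset.sum_lt_sum (fun j _ => hle j)
      ⟨j, Finset.mem_univ j, lt_of_le_of_ne (hle j) hj⟩)

theorem mem_span_x {P : Set (Mon m n)} {y : Omega q m n} :
    y ∈ Submodule.span K (Omega.x q '' P) ↔
      ∀ β, (Omega.basis q m n).repr y β ≠ 0 → β ∈ P := by
  rw [show Omega.x q '' P = Omega.basis q m n '' P from rfl, Module.Basis.mem_span_image]
  simp only [Set.subset_def, Finset.mem_coe, Finsupp.mem_support_iff]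

theorem x_mem_span {P : Set (Mon m n)} {β : Mon m n} :
    Omega.x q β ∈ Submodule.span K (Omega.x q '' P) ↔ β ∈ P := by
  classical
  rw [mem_span_x, ← Omega.x_def, Module.Basis.repr_self]
  simp [Finsupp.single_apply]

theorem repr_x (β γ : Mon m n) [Decidable (β = γ)] :
    (Omega.basis q m n).repr (Omega.x q β) γ = if β = γ then 1 else 0 := by
  classical
  rw [← Omega.x_def, Module.Basis.repr_self, Finsupp.single_apply]

/-- The coefficient of `b y` at a monomial which occurs in `b x^β` for only one monomial `x^β` of
`y`. -/
theorem repr_map_eq (b : Module.End K (Omega q m n)) (y : Omega q m n) (β γ : Mon m n)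
    (h : ∀ β', (Omega.basis q m n).repr y β' ≠ 0 → β' ≠ β →
      (Omega.basis q m n).repr (b (Omega.x q β')) γ = 0) :
    (Omega.basis q m n).repr (b y) γ =
      (Omega.basis q m n).repr y β * (Omega.basis q m n).repr (b (Omega.x q β)) γ := by
  conv_lhs => rw [← (Omega.basis q m n).linearCombination_repr y]
  rw [Finsupp.linearCombination_apply, Finsupp.sum, map_sum, map_sum, Finsupp.finsetSum_apply]
  simp only [map_smul, Finsupp.smul_apply, smul_eq_mul, Omega.x_def]
  apply Finset.sum_eq_single
  · intro β' hβ' hne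
    rw [h β' (Finsupp.mem_support_iff.mp hβ') hne, mul_zero]
  · intro hβ
    rw [Finsupp.notMem_support_iff.mp hβ, zero_mul]

theorem repr_projection {a : Fin (m + n) → ℕ} {b : Module.End K (Omega q m n)}
    (hb : ∀ β : Mon m n, b (Omega.x q β) = if β.res (qChar q) = a then Omega.x q β else 0)
    (y : Omega q m n) (γ : Mon m n) : (Omega.basis q m n).repr (b y) γ =
      if γ.res (qChar q) = a then (Omega.basis q m n).repr y γ else 0 := by
  classical
  rw [repr_map_eq q b y γ γ, hb γ]
  · split_ifs
    · rw [repr_x, if_pos rfl, mul_one]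
    · rw [map_zero, Finsupp.zero_apply, mul_zero]
  · intro β' _ hne
    rw [hb β']
    split_ifs
    · rw [repr_x, if_neg hne]
    · rw [map_zero, Finsupp.zero_apply]

theorem OmegaTrunc_map_mem {r s : ℕ} {b : Module.End K (Omega q m n)}
    (hb : b ∈ (Uq.act q m n).range) {y : Omega q m n} (hy : y ∈ OmegaTrunc q m n r s) :
    b y ∈ OmegaTrunc q m n r s := by
  obtain ⟨u, rfl⟩ := hb
  exact Uq.act_mem q m n r s u hy

/-- Read off from the invariance of the truncation: the image of x^β lies in it, and is a nonzero
multiple of the moved monomial. -/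
theorem move_mem_monTrunc {r s : ℕ} {β : Mon m n} (hβ : β ∈ monTrunc q m n r s)
    {i k : Fin (m + n)} (h : k ≠ i) (h0 : β.1 i ≠ 0) (hc : raiseCoeff q k β ≠ 0) :
    β.move i k ∈ monTrunc q m n r s := by
  have h1 := word_mem q m n r s h hβ
  rw [word_x q h, if_neg h0, Submodule.smul_mem_iff _ hc] at h1
  exact (x_mem_span q).mp h1

end range

/-! ### Extreme energies and the energy filtration -/

section energies
variable {K : Type*} [Field K] [CharZero K] (q : K) [Fact (3 ≤ qChar q)] {m n r s : ℕ}

/-- The bound on s is the total capacity of the box of exponents, so `exists_sum_eq_of_le` fills the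
box up to degree s. -/
theorem monTrunc_nonempty (hr : 1 ≤ r) (hs : s ≤ m * (r * qChar q - 1) + n) :
    (monTrunc q m n r s).Nonempty := by
  have h3 : 3 ≤ qChar q := Fact.out
  have hrl : 0 < r * qChar q := Nat.mul_pos hr (by omega)
  obtain ⟨f, -, hf, hfs⟩ := exists_sum_eq_of_le (c := 0)
    (d := fun k : Fin (m + n) => if k.val < m then r * qChar q - 1 else 1)
    (fun _ => Nat.zero_le _) s (by simp) (by simpa [Fin.sum_univ_add] using hs)
  have hf' : ∀ k, f k ≤ if k.val < m then r * qChar q - 1 else 1 := hf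
  refine ⟨⟨f, fun k hk => ?_⟩, hfs, fun k hk => ?_⟩
  · have := hf' k
    rwa [if_neg (by omega)] at this
  · have := hf' k
    rw [if_pos hk] at this
    simp only
    omega

/-- The energy of a nonzero element is attained at one of its monomials. The extreme energies can
therefore be computed on monomials. -/
theorem energies_eq : {t : ℕ | ∃ y ∈ OmegaTrunc q m n r s, y ≠ 0 ∧ Edeg q y = t} =
    Mon.energy (qChar q) '' monTrunc q m n r s := by
  classical
  ext t
  constructor
  · rintro ⟨y, hy, hy0, rfl⟩
    have hne : ((Omega.basis q m n).repr y).support.Nonempty := by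
      rw [Finsupp.support_nonempty_iff]
      exact fun h => hy0 ((Omega.basis q m n).repr.map_eq_zero_iff.mp h)
    obtain ⟨β, hβ, h⟩ := Finset.exists_mem_eq_sup _ hne (Mon.energy (qChar q))
    exact ⟨β, (mem_span_x q).mp hy β (Finsupp.mem_support_iff.mp hβ), h.symm⟩
  · rintro ⟨β, hβ, rfl⟩
    refine ⟨Omega.x q β, (x_mem_span q).mpr hβ, (Omega.basis q m n).ne_zero β, ?_⟩
    rw [Edeg, ← Omega.x_def, Module.Basis.repr_self, Finsupp.support_single,
      Finset.sup_singleton]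
    exact one_ne_zero

theorem lowEnergy_le {β : Mon m n} (hβ : β ∈ monTrunc q m n r s) :
    lowEnergy q m n r s ≤ β.energy (qChar q) := by
  rw [lowEnergy, energies_eq]
  exact Nat.sInf_le ⟨β, hβ, rfl⟩

theorem exists_energy_eq_lowEnergy (h : (monTrunc q m n r s).Nonempty) :
    ∃ β ∈ monTrunc q m n r s, β.energy (qChar q) = lowEnergy q m n r s := by
  rw [lowEnergy, energies_eq]
  exact Nat.sInf_mem (h.image _)

theorem bddAbove_energies : BddAbove (Mon.energy (qChar q) '' monTrunc q m n r s) := by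
  have h3 : 3 ≤ qChar q := Fact.out
  refine ⟨s, ?_⟩
  rintro _ ⟨β, hβ, rfl⟩
  rw [← hβ.1, β.deg_eq (l := qChar q) (by omega)]
  exact (Nat.le_mul_of_pos_left _ (by omega)).trans (Nat.le_add_left _ _)

theorem le_highEnergy {β : Mon m n} (hβ : β ∈ monTrunc q m n r s) :
    β.energy (qChar q) ≤ highEnergy q m n r s := by
  rw [highEnergy, energies_eq]
  exact le_csSup (bddAbove_energies q) ⟨β, hβ, rfl⟩

theorem exists_energy_eq_highEnergy (h : (monTrunc q m n r s).Nonempty) :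
    ∃ β ∈ monTrunc q m n r s, β.energy (qChar q) = highEnergy q m n r s := by
  rw [highEnergy, energies_eq]
  exact Nat.sSup_mem (h.image _) (bddAbove_energies q)

variable {q} in
theorem sum_res_add {β : Mon m n} (hβ : β ∈ monTrunc q m n r s) :
    ∑ k, β.res (qChar q) k + qChar q * β.energy (qChar q) = s := by
  have h3 : 3 ≤ qChar q := Fact.out
  rw [← β.deg_eq (l := qChar q) (by omega), hβ.1]

variable {q} in
-- Since s = Σa_k + ℓ·energy, the projections by residues separate the energy grades. They need not
-- separate monomials within a grade.
theorem energy_eq_of_res_eq {β γ : Mon m n} (hβ : β ∈ monTrunc q m n r s)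
    (hγ : γ ∈ monTrunc q m n r s) (h : β.res (qChar q) = γ.res (qChar q)) :
    β.energy (qChar q) = γ.energy (qChar q) := by
  have h3 : 3 ≤ qChar q := Fact.out
  have h1 := sum_res_add hβ
  have h2 := sum_res_add hγ
  rw [h] at h1
  exact Nat.eq_of_mul_eq_mul_left (by omega : 0 < qChar q) (by omega)

variable (m n r s) in
/-- The span of the monomials of energy grade less than `E₀(s) + k`. -/
noncomputable def energyLt (k : ℕ) : Submodule K (Omega q m n) :=
  Submodule.span K (Omega.x q '' {β | β ∈ monTrunc q m n r s ∧
    β.energy (qChar q) < lowEnergy q m n r s + k})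

theorem energyLt_le (k : ℕ) : energyLt q m n r s k ≤ OmegaTrunc q m n r s :=
  Submodule.span_mono (Set.image_mono fun _ h => h.1)

theorem energyLt_mono : Monotone (energyLt q m n r s) := fun _ _ hjk =>
  Submodule.span_mono (Set.image_mono fun _ h => ⟨h.1, h.2.trans_le (Nat.add_le_add_left hjk _)⟩)

theorem energyLt_map_mem {k : ℕ} {b : Module.End K (Omega q m n)}
    (hb : b ∈ (Uq.act q m n).range) {y : Omega q m n} (hy : y ∈ energyLt q m n r s k) :
    b y ∈ energyLt q m n r s k := by
  have h3 : 3 ≤ qChar q := Fact.out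
  refine map_mem_span_of_closed q (fun β hβ i k hik h0 hc => ?_) hb hy
  refine ⟨move_mem_monTrunc q hβ.1 hik.ne.symm h0 hc, ?_⟩
  rcases quo_move_or_energy_lt hik.ne.symm hc with h | h
  · rw [Mon.energy_eq_sum_quo (by omega), h, ← Mon.energy_eq_sum_quo (by omega)]
    exact hβ.2
  · exact h.trans hβ.2

/-- The strict inequality in `energyLt` shifts the index by one, so that the filtration starts with
0, as the criterion requires. -/
theorem energyLt_succ (i : ℕ) : energyLt q m n r s (i + 1) = energyFiltration q m n r s i := by
  unfold energyLt energyFiltration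
  congr 2
  ext β
  exact ⟨fun h => ⟨h.1, lowEnergy_le q h.1, Nat.lt_succ_iff.mp h.2⟩,
    fun h => ⟨h.1, Nat.lt_succ_iff.mpr h.2.2⟩⟩

end energies

/-! ### Submodules: descent, ascent and recovery of monomials -/

section submodules
variable {K : Type*} [Field K] [CharZero K] (q : K) [Fact (3 ≤ qChar q)] {m n : ℕ}

/-- The elements of `A` act on `Ω_q(m|n)` by the same operators as those of `U_q(gl(m|n))`. -/
structure IsQuantumAction (m n : ℕ) (A : Type*) [Ring A] [Module A (Omega q m n)] : Prop where
  exists_op : ∀ a : A, ∃ b ∈ (Uq.act q m n).range, ∀ y : Omega q m n, a • y = b y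
  exists_smul : ∀ b ∈ (Uq.act q m n).range, ∃ a : A, ∀ y : Omega q m n, a • y = b y

theorem Uq.isQuantumAction : IsQuantumAction q m n (Uq q m n) where
  exists_op u := ⟨Uq.act q m n u, ⟨u, rfl⟩, fun _ => rfl⟩
  exists_smul := by
    rintro _ ⟨u, rfl⟩
    exact ⟨u, fun _ => rfl⟩

/-- The action of U_q factors through the surjection onto u_q, so both algebras have the same image.
-/
theorem SmallUq.isQuantumAction : IsQuantumAction q m n (SmallUq q m n) where
  exists_op u := by
    obtain ⟨w, rfl⟩ := SmallUq.mk_surjective q m n u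
    exact ⟨Uq.act q m n w, ⟨w, rfl⟩, fun y => by rw [SmallUq.smul_def, SmallUq.act_mk]⟩
  exists_smul := by
    rintro _ ⟨w, rfl⟩
    exact ⟨SmallUq.mk q m n w, fun y => by rw [SmallUq.smul_def, SmallUq.act_mk]; rfl⟩

variable {q} {A : Type*} [Ring A] [Module A (Omega q m n)]

theorem IsQuantumAction.map_mem (hA : IsQuantumAction q m n A) {N : Submodule A (Omega q m n)}
    {b : Module.End K (Omega q m n)} (hb : b ∈ (Uq.act q m n).range) {y : Omega q m n}
    (hy : y ∈ N) : b y ∈ N := by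
  obtain ⟨a, ha⟩ := hA.exists_smul b hb
  rw [← ha]
  exact N.smul_mem a hy

/-- A is only a ring here; its submodules are nevertheless K-subspaces, because the scalar operators
belong to the image of the algebra. -/
theorem IsQuantumAction.smul_mem (hA : IsQuantumAction q m n A) {N : Submodule A (Omega q m n)}
    (c : K) {y : Omega q m n} (hy : y ∈ N) : c • y ∈ N := by
  have := hA.map_mem (Subalgebra.algebraMap_mem (Uq.act q m n).range c) hy
  rwa [Module.algebraMap_end_apply] at this

theorem IsQuantumAction.span_le (hA : IsQuantumAction q m n A) {N : Submodule A (Omega q m n)}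
    {P : Set (Mon m n)} (hP : ∀ β ∈ P, Omega.x q β ∈ N) {y : Omega q m n}
    (hy : y ∈ Submodule.span K (Omega.x q '' P)) : y ∈ N := by
  induction hy using Submodule.span_induction with
  | mem x hx => obtain ⟨β, hβ, rfl⟩ := hx; exact hP β hβ
  | zero => exact N.zero_mem
  | add x y _ _ hx hy => exact N.add_mem hx hy
  | smul a x _ hx => exact hA.smul_mem a hx

theorem Mon.res_lt (β : Mon m n) (i : Fin (m + n)) : β.res (qChar q) i < qChar q :=
  Nat.mod_lt _ (by have : 3 ≤ qChar q := Fact.out; omega)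

theorem lt_of_quo_ne_zero {β : Mon m n} {i : Fin (m + n)} (h : β.quo (qChar q) i ≠ 0) :
    i.val < m := by
  by_contra hi
  exact h (β.quo_eq_zero (by have : 3 ≤ qChar q := Fact.out; omega) i (by omega))

theorem sum_quo_of_add_single {κ κ' : Fin (m + n) → ℕ} {i : Fin (m + n)}
    (h : κ' + Pi.single i 1 = κ) : ∑ k, κ' k + 1 = ∑ k, κ k := by
  rw [← h]
  simp [Finset.sum_add_distrib]

variable {r s : ℕ}

theorem monTrunc_of_quo_lt {β : Mon m n} (hs : β.deg = s)
    (h : ∀ k : Fin (m + n), k.val < m → β.quo (qChar q) k < r) : β ∈ monTrunc q m n r s :=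
  ⟨hs, fun k hk => (Nat.div_lt_iff_lt_mul (by have : 3 ≤ qChar q := Fact.out; omega)).mp (h k hk)⟩

theorem quo_lt_of_mem_monTrunc {β : Mon m n} (hβ : β ∈ monTrunc q m n r s) {k : Fin (m + n)}
    (hk : k.val < m) : β.quo (qChar q) k < r :=
  (Nat.div_lt_iff_lt_mul (by have : 3 ≤ qChar q := Fact.out; omega)).mpr (hβ.2 k hk)

/-- A submodule which has an element outside of `energyLt k` has one in
`energyLt (k + 1)` outside of `energyLt k`. -/
theorem IsQuantumAction.exists_mem_energyLt_succ (hA : IsQuantumAction q m n A) (hm : 2 ≤ m)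
    {N : Submodule A (Omega q m n)} {k : ℕ} {y : Omega q m n} (hy : y ∈ N)
    (hyT : y ∈ OmegaTrunc q m n r s) (hyk : y ∉ energyLt q m n r s k) :
    ∃ z ∈ N, z ∈ energyLt q m n r s (k + 1) ∧ z ∉ energyLt q m n r s k := by
  have h3 : 3 ≤ qChar q := Fact.out
  have key : ∀ d, ∀ y ∈ N, y ∈ OmegaTrunc q m n r s → ∀ β,
      (Omega.basis q m n).repr y β ≠ 0 → β.energy (qChar q) = lowEnergy q m n r s + k + d →
      ∃ z ∈ N, z ∈ energyLt q m n r s (k + 1) ∧ z ∉ energyLt q m n r s k := by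
    intro d
    induction d with
    | zero =>
      intro y hy hyT β hβ hd
      have hβT := (mem_span_x q).mp hyT β hβ
      -- The projection keeps x^β and only monomials of the same residues, hence of the same energy
      -- E₀(s) + k.
      obtain ⟨b, hb, hbx⟩ := exists_projection q (β.res (qChar q)) β.res_lt
      refine ⟨b y, hA.map_mem hb hy, (mem_span_x q).mpr fun γ hγ => ?_, fun h => ?_⟩
      · rw [repr_projection q hbx] at hγ
        split_ifs at hγ with hr
        · have hγT := (mem_span_x q).mp hyT γ hγ
          have := energy_eq_of_res_eq hγT hβT hr
          exact ⟨hγT, by omega⟩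
        · exact absurd rfl hγ
      · have := (mem_span_x q).mp h β (by rwa [repr_projection q hbx, if_pos rfl])
        have := this.2
        omega
    | succ d ih =>
      intro y hy hyT β hβ hd
      have hβT := (mem_span_x q).mp hyT β hβ
      obtain ⟨p, hp, hpx⟩ := exists_projection q (β.res (qChar q)) β.res_lt
      obtain ⟨βm, hβm, hmin⟩ := exists_energy_eq_lowEnergy q ⟨β, hβT⟩
      have hs1 := sum_res_add hβT
      have hs2 := sum_res_add hβm
      obtain ⟨i, -, hi⟩ := Finset.exists_ne_zero_of_sum_ne_zero
        (s := Finset.univ) (f := β.quo (qChar q))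
        (by rw [← β.energy_eq_sum_quo (by omega)]; omega)
      -- Room for ℓ more units of residue: a monomial of the lowest energy has the same degree and
      -- strictly less energy than β, so its residues exceed those of β by at least ℓ in total.
      have hle : ∑ k, β.res (qChar q) k + qChar q ≤ ∑ k, cap m n (qChar q) k := by
        refine le_trans ?_ (Finset.sum_le_sum fun k _ => βm.res_le_cap (l := qChar q) (by omega) k)
        have h4 : qChar q * (βm.energy (qChar q) + 1) ≤ qChar q * β.energy (qChar q) :=
          Nat.mul_le_mul_left _ (by omega)
        rw [mul_add, mul_one] at h4
        omega
      obtain ⟨a', -, ha', hsum⟩ := exists_sum_eq_of_le (c := 0) (d := cap m n (qChar q))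
        (fun _ => Nat.zero_le _) (∑ k, β.res (qChar q) k + qChar q) (by simp) hle
      obtain ⟨b, hb, hbx⟩ := drop_of_sum_eq (q := q) hm (lt_of_quo_ne_zero hi) ha' hsum
      obtain ⟨β', c, hc, h1, h2, h4⟩ := (hbx β rfl).2 hi
      -- No cancellation: after the projection all monomials have equal residues, and on those not
      -- killed, lowering κ_i by one is injective.
      have hne : (Omega.basis q m n).repr (b (p y)) β' ≠ 0 := by
        classical
        rw [repr_map_eq q b (p y) β β', h4, map_smul, Finsupp.smul_apply, repr_x, if_pos rfl,
          repr_projection q hpx, if_pos rfl, smul_eq_mul, mul_one]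
        · exact mul_ne_zero hβ hc
        intro γ hγ hγβ
        rw [repr_projection q hpx] at hγ
        split_ifs at hγ with hr
        · by_cases h0 : γ.quo (qChar q) i = 0
          · rw [(hbx γ hr).1 h0, map_zero, Finsupp.zero_apply]
          · obtain ⟨γ', c', -, h1', h2', h4'⟩ := (hbx γ hr).2 h0
            rw [h4', map_smul, Finsupp.smul_apply, repr_x, if_neg, smul_zero]
            rintro rfl
            exact hγβ (Mon.ext_res_quo hr (h2'.symm.trans h2))
        · exact absurd rfl hγ
      refine ih (b (p y)) (hA.map_mem hb (hA.map_mem hp hy))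
        (OmegaTrunc_map_mem q hb (OmegaTrunc_map_mem q hp hyT)) β' hne ?_
      have h5 := sum_quo_of_add_single h2
      rw [← Mon.energy_eq_sum_quo (by omega), ← Mon.energy_eq_sum_quo (by omega)] at h5
      omega
  rw [energyLt, mem_span_x] at hyk
  push Not at hyk
  obtain ⟨β, hβ, hβk⟩ := hyk
  have h4 : lowEnergy q m n r s + k ≤ β.energy (qChar q) := by
    by_contra h
    exact hβk ⟨(mem_span_x q).mp hyT β hβ, by omega⟩
  exact key (β.energy (qChar q) - (lowEnergy q m n r s + k)) y hy hyT β hβ (by omega)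

/-- Each monomial of an energy grade that is not maximal is obtained from a monomial of the next
energy grade. -/
theorem exists_map_eq_x (hm : 2 ≤ m) {β : Mon m n} (hβ : β ∈ monTrunc q m n r s)
    (h : β.energy (qChar q) < highEnergy q m n r s) :
    ∃ γ ∈ monTrunc q m n r s, γ.energy (qChar q) = β.energy (qChar q) + 1 ∧
      ∃ b ∈ (Uq.act q m n).range, ∃ c : K, c ≠ 0 ∧ b (Omega.x q γ) = c • Omega.x q β := by
  have h3 : 3 ≤ qChar q := Fact.out
  obtain ⟨βt, hβt, hmax⟩ := exists_energy_eq_highEnergy q ⟨β, hβ⟩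
  rw [← hmax] at h
  have hs1 := sum_res_add hβ
  have hs2 := sum_res_add hβt
  have h4 : qChar q * (β.energy (qChar q) + 1) ≤ qChar q * βt.energy (qChar q) :=
    Nat.mul_le_mul_left _ h
  rw [mul_add, mul_one] at h4
  rw [β.energy_eq_sum_quo (by omega), βt.energy_eq_sum_quo (by omega)] at h
  -- Comparison with a monomial of the highest energy gives a place with κ_i(β) < κ_i(βt) < r, where
  -- κ_i may be raised without leaving the truncation.
  obtain ⟨i, -, hi⟩ := Finset.exists_lt_of_sum_lt h
  have him : i.val < m := lt_of_quo_ne_zero (by omega : βt.quo (qChar q) i ≠ 0)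
  have hcap : ∀ k, β.res (qChar q) k ≤ cap m n (qChar q) k := β.res_le_cap (by omega)
  -- The subtraction of ℓ is not truncated: `βt` has the same degree and more energy, so the
  -- residues of β sum to at least ℓ.
  obtain ⟨a, -, ha, hsum⟩ := exists_sum_eq_of_le (c := 0) (d := cap m n (qChar q))
    (fun _ => Nat.zero_le _) (∑ k, β.res (qChar q) k - qChar q) (by simp)
    ((Nat.sub_le _ _).trans (Finset.sum_le_sum fun k _ => hcap k))
  obtain ⟨γ, hγ1, hγ2⟩ := Mon.exists_res_quo (m := m) (n := n) (l := qChar q) (by omega) ha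
    (κ := β.quo (qChar q) + Pi.single i 1) (fun k hk => by
      rw [Pi.add_apply, β.quo_eq_zero (by omega) k hk, Pi.single_apply,
        if_neg (by rintro rfl; omega), add_zero])
  have hE : γ.energy (qChar q) = β.energy (qChar q) + 1 := by
    rw [γ.energy_eq_sum_quo (by omega), β.energy_eq_sum_quo (by omega)]
    exact (sum_quo_of_add_single hγ2.symm).symm
  obtain ⟨b, hb, hbx⟩ := drop_of_sum_eq (q := q) hm him hcap
    (show ∑ k, β.res (qChar q) k = ∑ k, a k + qChar q by omega)
  obtain ⟨β', c, hc, h1, h2, h5⟩ := (hbx γ hγ1).2 (by rw [hγ2]; simp)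
  have hββ : β' = β := Mon.ext_res_quo h1 (add_right_cancel (h2.trans hγ2))
  refine ⟨γ, monTrunc_of_quo_lt ?_ fun k hk => ?_, hE, b, hb, c, hc, hββ ▸ h5⟩
  · rw [γ.deg_eq (l := qChar q) (by omega), hE, hγ1, hsum, mul_add, mul_one]
    omega
  · rw [hγ2, Pi.add_apply, Pi.single_apply]
    have h6 := quo_lt_of_mem_monTrunc hβ hk
    have h7 := quo_lt_of_mem_monTrunc hβt hk
    split_ifs with h8
    · subst h8; omega
    · omega

/-- A submodule that contains `energyLt (k + 1)` up to `energyLt k` contains `energyLt k`. -/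
theorem IsQuantumAction.energyLt_le (hA : IsQuantumAction q m n A) (hm : 2 ≤ m)
    {N : Submodule A (Omega q m n)} {k : ℕ}
    (hk : lowEnergy q m n r s + k ≤ highEnergy q m n r s)
    (h : ∀ y ∈ energyLt q m n r s (k + 1), ∃ u ∈ N, y - u ∈ energyLt q m n r s k)
    {y : Omega q m n} (hy : y ∈ energyLt q m n r s k) : y ∈ N := by
  have key : ∀ d, ∀ β ∈ monTrunc q m n r s,
      β.energy (qChar q) + d = lowEnergy q m n r s + k → Omega.x q β ∈ N := by
    intro d
    induction d with
    | zero =>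
      intro β hβ hd
      obtain ⟨u, hu, hv⟩ := h (Omega.x q β) ((x_mem_span q).mpr ⟨hβ, by omega⟩)
      obtain ⟨b, hb, hbx⟩ := exists_projection q (β.res (qChar q)) β.res_lt
      -- The difference has energy below that of β, so none of its monomials has the residues of β.
      -- Hence x^β is the projection of u, and lies in N.
      have h0 : b (Omega.x q β - u) = 0 := by
        apply (Omega.basis q m n).repr.map_eq_zero_iff.mp
        ext γ
        rw [repr_projection q hbx, Finsupp.zero_apply]
        split_ifs with hr
        · by_contra hγ
          have h4 := (mem_span_x q).mp hv γ hγ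
          have := energy_eq_of_res_eq h4.1 hβ hr
          have := h4.2
          omega
        · rfl
      rw [map_sub, hbx, if_pos rfl, sub_eq_zero] at h0
      rw [h0]
      exact hA.map_mem hb hu
    | succ d ih =>
      intro β hβ hd
      -- Lower energies are reached from the grade E₀(s) + k, one step at a time.
      obtain ⟨γ, hγ, hE, b, hb, c, hc, hbx⟩ := exists_map_eq_x hm hβ (by omega)
      have h4 := hA.smul_mem c⁻¹ (hA.map_mem hb (ih γ hγ (by omega)))
      rwa [hbx, smul_smul, inv_mul_cancel₀ hc, one_smul] at h4
  refine hA.span_le (fun β hβ => ?_) hy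
  exact key (lowEnergy q m n r s + k - β.energy (qChar q)) β hβ.1 (by have := hβ.2; omega)

/-- A monomial can be recovered from each of its multiples that does not have lower energy. -/
theorem exists_map_map_x_eq {β : Mon m n} (hβ : β ∈ monTrunc q m n r s) {k : ℕ}
    (hk : β.energy (qChar q) = lowEnergy q m n r s + k) {b : Module.End K (Omega q m n)}
    (hb : b ∈ (Uq.act q m n).range) (h : b (Omega.x q β) ∉ energyLt q m n r s k) :
    ∃ b' ∈ (Uq.act q m n).range, b' (b (Omega.x q β)) = Omega.x q β := by
  classical
  have h3 : 3 ≤ qChar q := Fact.out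
  -- A move keeps the quotients or lowers the energy, so P is closed under moves. In b x^β all
  -- monomials of the energy of β thus have its quotients, and residues tell them apart.
  set P : Set (Mon m n) := {γ | γ ∈ monTrunc q m n r s ∧ (γ.quo (qChar q) = β.quo (qChar q) ∨
    γ.energy (qChar q) < lowEnergy q m n r s + k)}
  have hE : ∀ γ : Mon m n, γ.quo (qChar q) = β.quo (qChar q) →
      γ.energy (qChar q) = lowEnergy q m n r s + k := fun γ h => by
    rw [← hk, γ.energy_eq_sum_quo (by omega), β.energy_eq_sum_quo (by omega), h]
  have hbP : b (Omega.x q β) ∈ Submodule.span K (Omega.x q '' P) := by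
    refine map_mem_span_of_closed q (fun γ hγ i j hij h0 hc => ?_) hb
      ((x_mem_span q).mpr ⟨hβ, Or.inl rfl⟩)
    refine ⟨move_mem_monTrunc q hγ.1 hij.ne.symm h0 hc, ?_⟩
    have hle : γ.energy (qChar q) ≤ lowEnergy q m n r s + k := by
      rcases hγ.2 with h1 | h1
      · exact (hE γ h1).le
      · exact h1.le
    rcases quo_move_or_energy_lt hij.ne.symm hc with h1 | h1
    · rw [Mon.energy_eq_sum_quo (by omega), h1, ← Mon.energy_eq_sum_quo (by omega)]
      exact hγ.2
    · exact Or.inr (by omega)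
  rw [energyLt, mem_span_x] at h
  push Not at h
  obtain ⟨γ, hγ, hγk⟩ := h
  obtain ⟨hγT, hγq⟩ := (mem_span_x q).mp hbP γ hγ
  replace hγq := hγq.resolve_right fun h1 => hγk ⟨hγT, h1⟩
  obtain ⟨p, hp, hpx⟩ := exists_projection q (γ.res (qChar q)) γ.res_lt
  set c := (Omega.basis q m n).repr (b (Omega.x q β)) γ with hc
  -- Only γ survives: another monomial of P with its residues would have the same energy, hence the
  -- same quotients.
  have h1 : p (b (Omega.x q β)) = c • Omega.x q γ := by
    apply (Omega.basis q m n).repr.injective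
    ext δ
    rw [repr_projection q hpx, map_smul, Finsupp.smul_apply, repr_x]
    by_cases hδ : γ = δ
    · subst hδ; simp [hc]
    · rw [if_neg hδ, smul_zero]
      split_ifs with hr
      · by_contra hne
        obtain ⟨hδT, hδq⟩ := (mem_span_x q).mp hbP δ hne
        rcases hδq with h4 | h4
        · exact hδ (Mon.ext_res_quo hr.symm (hγq.trans h4.symm))
        · rw [energy_eq_of_res_eq hδT hγT hr, hE γ hγq] at h4
          exact lt_irrefl _ h4
      · rfl
  obtain ⟨b', hb', hbx'⟩ := reach_of_sum_eq (q := q) (a := γ.res (qChar q))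
    (a' := β.res (qChar q)) (β.res_le_cap (by omega)) (by
      have h4 := sum_res_add hγT
      have h5 := sum_res_add hβ
      rw [hE γ hγq] at h4
      rw [hk] at h5
      omega)
  obtain ⟨β', c', hc', h4, h5, h6⟩ := hbx' γ rfl
  have hββ : β' = β := Mon.ext_res_quo h4 (h5.trans hγq)
  refine ⟨(c * c')⁻¹ • (b' * p), Subalgebra.smul_mem _ (mul_mem hb' hp) _, ?_⟩
  rw [LinearMap.smul_apply, Module.End.mul_apply, h1, map_smul, h6, hββ, smul_smul, smul_smul,
    mul_assoc, inv_mul_cancel₀ (mul_ne_zero hγ hc'), one_smul]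

end submodules

/-! ### The energy filtration satisfies the criterion -/

section rigidity
variable {K : Type*} [Field K] [CharZero K] {q : K} [Fact (3 ≤ qChar q)] {m n r s : ℕ}
  {A : Type*} [Ring A] [Module A (Omega q m n)]

/-- The energy filtration of a submodule with the underlying space `Ω_q^(s)(m|n, 𝐫)`. -/
noncomputable def energySubmodule (hA : IsQuantumAction q m n A) (T : Submodule A (Omega q m n))
    (r s k : ℕ) : Submodule A T where
  carrier := {y | (y : Omega q m n) ∈ energyLt q m n r s k}
  add_mem' := (energyLt q m n r s k).add_mem
  zero_mem' := (energyLt q m n r s k).zero_mem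
  smul_mem' a y hy := by
    obtain ⟨b, hb, h⟩ := hA.exists_op a
    rw [Set.mem_ofPred_eq, Submodule.coe_smul, h]
    exact energyLt_map_mem q hb hy

theorem mem_energySubmodule (hA : IsQuantumAction q m n A) {T : Submodule A (Omega q m n)} {k : ℕ}
    {y : T} : y ∈ energySubmodule hA T r s k ↔ (y : Omega q m n) ∈ energyLt q m n r s k := Iff.rfl

theorem coe_map_energySubmodule (hA : IsQuantumAction q m n A) {T : Submodule A (Omega q m n)}
    (hT : (T : Set (Omega q m n)) = OmegaTrunc q m n r s) (i : ℕ) :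
    ((energySubmodule hA T r s (i + 1)).map T.subtype : Set (Omega q m n)) =
      energyFiltration q m n r s i := by
  rw [← energyLt_succ]
  ext y
  constructor
  · rintro ⟨y, hy, rfl⟩
    exact hy
  · intro hy
    have hyT : y ∈ (T : Set (Omega q m n)) := hT ▸ QGrass.energyLt_le q _ hy
    exact ⟨⟨y, hyT⟩, hy, rfl⟩

/-- The length is the number of integers from E₀(s) to E(s). As E(s) is attained by a monomial, no
term before the last is everything; the layers are generated by the monomials of exact energy E₀(s)
+ k. -/
theorem isLoewyFiltration_energySubmodule (hA : IsQuantumAction q m n A)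
    {T : Submodule A (Omega q m n)} (hT : (T : Set (Omega q m n)) = OmegaTrunc q m n r s)
    (hm : 2 ≤ m) (hne : (monTrunc q m n r s).Nonempty) :
    IsLoewyFiltration A T (highEnergy q m n r s - lowEnergy q m n r s + 1)
      (energySubmodule hA T r s) := by
  have hT' : ∀ {y}, y ∈ T ↔ y ∈ OmegaTrunc q m n r s := fun {y} => by
    rw [← SetLike.mem_coe, hT, SetLike.mem_coe]
  obtain ⟨βt, hβt, hmax⟩ := exists_energy_eq_highEnergy q hne
  have hle := lowEnergy_le q hβt
  refine ⟨fun j k hjk y hy => ?_, ?_, ?_, fun k hk h => ?_, fun k hk => ?_, fun k hk N hN h => ?_,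
    fun k hk h0 N h => ?_⟩
  · exact energyLt_mono q hjk hy
  · rw [eq_bot_iff]
    intro y hy
    rw [mem_energySubmodule, energyLt] at hy
    rw [Submodule.mem_bot, ← Submodule.coe_eq_zero, ← (Omega.basis q m n).repr.map_eq_zero_iff]
    ext β
    by_contra hβ
    have h4 := (mem_span_x q).mp hy β hβ
    exact absurd h4.2 (by have := lowEnergy_le q h4.1; omega)
  · rw [eq_top_iff]
    rintro ⟨y, hy⟩ -
    refine (mem_span_x q).mpr fun β hβ => ?_
    have h4 := (mem_span_x q).mp (hT'.mp hy) β hβ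
    exact ⟨h4, by have := le_highEnergy q h4; omega⟩
  · have h4 : (⟨Omega.x q βt, hT'.mpr ((x_mem_span q).mpr hβt)⟩ : T) ∈
        energySubmodule hA T r s k := h ▸ Submodule.mem_top
    have := ((x_mem_span q).mp h4).2
    omega
  · refine isSemisimpleModule_map_mkQ (G := {y : T | ∃ β ∈ monTrunc q m n r s,
      β.energy (qChar q) = lowEnergy q m n r s + k ∧ (y : Omega q m n) = Omega.x q β}) ?_ ?_
    · apply le_antisymm
      · have h4 : ∀ {y}, y ∈ energyLt q m n r s (k + 1) →
            y ∈ (energySubmodule hA T r s k ⊔ Submodule.span A {y : T | ∃ β ∈ monTrunc q m n r s,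
              β.energy (qChar q) = lowEnergy q m n r s + k ∧
              (y : Omega q m n) = Omega.x q β}).map T.subtype := by
          intro y
          refine hA.span_le fun β hβ => ?_
          refine ⟨⟨Omega.x q β, hT'.mpr ((x_mem_span q).mpr hβ.1)⟩, ?_, rfl⟩
          rcases Nat.lt_or_ge (β.energy (qChar q)) (lowEnergy q m n r s + k) with h5 | h5
          · exact Submodule.mem_sup_left ((x_mem_span q).mpr ⟨hβ.1, h5⟩)
          · refine Submodule.mem_sup_right (Submodule.subset_span ⟨β, hβ.1, ?_, rfl⟩)
            have := hβ.2
            omega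
        intro y hy
        obtain ⟨z, hz, hzy⟩ := h4 hy
        exact (Subtype.ext hzy : z = y) ▸ hz
      · refine sup_le (fun y hy => ?_) (Submodule.span_le.mpr ?_)
        · exact energyLt_mono q (Nat.le_succ k) hy
        · rintro y ⟨β, hβ, h4, h5⟩
          rw [SetLike.mem_coe, mem_energySubmodule, h5]
          exact (x_mem_span q).mpr ⟨hβ, by omega⟩
    · rintro y ⟨β, hβ, h4, h5⟩ a
      rw [or_iff_not_imp_left]
      intro h6
      obtain ⟨b, hb, hab⟩ := hA.exists_op a
      rw [mem_energySubmodule, Submodule.coe_smul, h5, hab] at h6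
      obtain ⟨b', hb', h7⟩ := exists_map_map_x_eq hβ h4 hb h6
      obtain ⟨a', ha'⟩ := hA.exists_smul b' hb'
      refine ⟨a', ?_⟩
      rw [mem_energySubmodule, Submodule.coe_sub, Submodule.coe_smul, Submodule.coe_smul, h5, hab,
        ha', h7, sub_self]
      exact zero_mem _
  · obtain ⟨y, hy, hyk⟩ := SetLike.not_le_iff_exists.mp hN
    obtain ⟨z, ⟨z, hz, rfl⟩, h4, h5⟩ := hA.exists_mem_energyLt_succ hm
      (N := N.map T.subtype) (y := y) (Submodule.mem_map_of_mem hy) (hT'.mp y.2) hyk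
    exact h5 (h ⟨hz, h4⟩)
  · intro y hy
    obtain ⟨z, hz, hzy⟩ := hA.energyLt_le hm (N := N.map T.subtype) (k := k) (r := r) (s := s) (by omega)
      (fun y hy => by
        have hyT : y ∈ T := hT'.mpr (QGrass.energyLt_le q _ hy)
        obtain ⟨u, hu, v, hv, huv⟩ := Submodule.mem_sup.mp (h (show ⟨y, hyT⟩ ∈ _ from hy))
        refine ⟨u, Submodule.mem_map_of_mem hu, ?_⟩
        rw [show y = u + v from (congrArg Subtype.val huv).symm, add_sub_cancel_left]
        exact hv) hy
    exact (Subtype.ext hzy : z = y) ▸ hz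

/-- Rigidity, for all algebras which act like the quantum general linear superalgebra. -/
theorem IsQuantumAction.rigidity (hA : IsQuantumAction q m n A)
    {T : Submodule A (Omega q m n)} (hT : (T : Set (Omega q m n)) = OmegaTrunc q m n r s)
    (hm : 2 ≤ m) (hne : (monTrunc q m n r s).Nonempty) :
    IsRigid A T ∧
      loewyLength A T = highEnergy q m n r s - lowEnergy q m n r s + 1 ∧
      ∀ i ≤ highEnergy q m n r s - lowEnergy q m n r s,
        ((socleFiltration A T (i + 1)).map T.subtype : Set (Omega q m n)) =
          energyFiltration q m n r s i ∧
        ((radicalFiltration A T (highEnergy q m n r s - lowEnergy q m n r s - i)).map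
          T.subtype : Set (Omega q m n)) = energyFiltration q m n r s i := by
  have h := isLoewyFiltration_energySubmodule hA hT hm hne
  refine ⟨h.isRigid, h.loewyLength_eq, fun i hi => ⟨?_, ?_⟩⟩
  · rw [h.socleFiltration_eq (i + 1) (by omega), coe_map_energySubmodule hA hT]
  · rw [h.radicalFiltration_eq _ (by omega), ← coe_map_energySubmodule hA hT]
    congr 3
    omega

end rigidity

end QGrass

theorem theorem26 {K : Type*} [Field K] [IsAlgClosed K] [CharZero K] (q : K)
    [Fact (3 ≤ QGrass.qChar q)] (m n r s : ℕ) (hm : 2 ≤ m) (hr : 1 ≤ r)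
    (hs : s ≤ m * (r * QGrass.qChar q - 1) + n) :
    (QGrass.IsRigid (QGrass.SmallUq q m n) (QGrass.SmallUq.truncModule q m n r s) ∧
      QGrass.loewyLength (QGrass.SmallUq q m n) (QGrass.SmallUq.truncModule q m n r s) =
        QGrass.highEnergy q m n r s - QGrass.lowEnergy q m n r s + 1 ∧
      ∀ i ≤ QGrass.highEnergy q m n r s - QGrass.lowEnergy q m n r s,
        ((QGrass.socleFiltration (QGrass.SmallUq q m n)
            (QGrass.SmallUq.truncModule q m n r s) (i + 1)).map
              (QGrass.SmallUq.truncModule q m n r s).subtype : Set (QGrass.Omega q m n)) =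
          QGrass.energyFiltration q m n r s i ∧
        ((QGrass.radicalFiltration (QGrass.SmallUq q m n)
            (QGrass.SmallUq.truncModule q m n r s)
            (QGrass.highEnergy q m n r s - QGrass.lowEnergy q m n r s - i)).map
              (QGrass.SmallUq.truncModule q m n r s).subtype : Set (QGrass.Omega q m n)) =
          QGrass.energyFiltration q m n r s i) ∧
    (QGrass.IsRigid (QGrass.Uq q m n) (QGrass.Uq.truncModule q m n r s) ∧
      QGrass.loewyLength (QGrass.Uq q m n) (QGrass.Uq.truncModule q m n r s) =
        QGrass.highEnergy q m n r s - QGrass.lowEnergy q m n r s + 1 ∧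
      ∀ i ≤ QGrass.highEnergy q m n r s - QGrass.lowEnergy q m n r s,
        ((QGrass.socleFiltration (QGrass.Uq q m n)
            (QGrass.Uq.truncModule q m n r s) (i + 1)).map
              (QGrass.Uq.truncModule q m n r s).subtype : Set (QGrass.Omega q m n)) =
          QGrass.energyFiltration q m n r s i ∧
        ((QGrass.radicalFiltration (QGrass.Uq q m n)
            (QGrass.Uq.truncModule q m n r s)
            (QGrass.highEnergy q m n r s - QGrass.lowEnergy q m n r s - i)).map
              (QGrass.Uq.truncModule q m n r s).subtype : Set (QGrass.Omega q m n)) =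
          QGrass.energyFiltration q m n r s i) := by
  have hne := QGrass.monTrunc_nonempty q (n := n) hr hs
  exact ⟨(QGrass.SmallUq.isQuantumAction q).rigidity rfl hm hne,
    (QGrass.Uq.isQuantumAction q).rigidity rfl hm hne⟩
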